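/- **Setting.** Let $\mathcal H_A=\mathcal H_{A_1}\otimes\mathcal H_{A_2}$ and $\mathcal H_{\bar A}=\mathcal H_{\bar A_1}\otimes\mathcal H_{\bar A_2}$ be finite-dimensional, $d=\dim\mathcal H_{A_1}\ge 2$, $\bar d=\dim\mathcal H_{\bar A_1}\ge 2$, $d_\chi=\dim\mathcal H_{A_2}\geq 1$, and let the logical space be $\mathcal H_L\cong\mathcal H_{A_1}\otimes\mathcal H_{\bar A_1}$. Let $V:\mathcal H_L\to\mathcal H_A\otimes\mathcal H_{\bar A}$ encode an exact code: there are unitaries $R_A^{(0)}$ on $\mathcal H_A$, $R_{\bar A}^{(0)}$ on $\mathcal H_{\bar A}$ and a vector $|\chi\rangle\in\mathcal H_{A_2}\otimes\mathcal H_{\bar A_2}$ with flat entanglement spectrum, $\mathrm{Tr}_{\bar A_2}|\chi\rangle\langle\chi|=I/d_\chi$, such that $(R_A^{(0)}\otimes R_{\bar A}^{(0)})V|\psi\rangle=|\psi\rangle_{A_1\bar A_1}|\chi\rangle_{A_2\bar A_2}$ for all $\psi$. Let $W$ be Hermitian on $\mathcal H_A\otimes\mathcal H_{\bar A}$, and let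 $V^{(\epsilon)}=e^{i\epsilon W}V$ be the skewed encoding. For unitaries $R_A,R_{\bar A}$ let $\mathcal N_R(\sigma)=\mathrm{Tr}_{A_2\bar A_2}\big[(R_A\otimes R_{\bar A})V^{(\epsilon)}\sigma V^{(\epsilon)\dagger}(R_A\otimes R_{\bar A})^\dagger\big]$, with coherent information $$I_c(\mathcal N_R)=S\big(\mathrm{Tr}_r[(\mathcal N_R\otimes I_r)(|\Phi\rangle\langle\Phi|)]\big)-S\big((\mathcal N_R\otimes I_r)(|\Phi\rangle\langle\Phi|)\big),$$ where $|\Phi\rangle$ is the maximally entangled state of $L$ and an isomorphic reference $r$, and $S$ is the von Neumann entropy. A *recovery* $R$ is a pair of families of unitaries $R_A^{(\epsilon)},R_{\bar A}^{(\epsilon)}$ ($\epsilon\in\mathbb R$), differentiable at $\epsilon=0$ and equal to $R_A^{(0)},R_{\bar A}^{(0)}$ there. Its operator $W_R$ is defined at leading order by $$(R_A^{(\epsilon)}\otimes R_{\bar A}^{(\epsilon)})\,e^{i\epsilon W}\,(R_A^{(0)}\otimes R_{\bar A}^{(0)})^\dagger=1+i\epsilon W_R+o(\epsilon).$$ $R$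 is *optimal* (to leading order in $\epsilon$) if for every recovery $R'$ and every $c>0$, $I_c(\mathcal N_{R'^{(\epsilon)}})\le I_c(\mathcal N_{R^{(\epsilon)}})+c\,\epsilon^2\log(1/\epsilon)$ for all sufficiently small $\epsilon>0$. Put $J=d_\chi\mathrm{Tr}_{\bar A_2}\{W_R,\,I\otimes|\chi\rangle\langle\chi|\}$ and $D=i\,d_\chi\mathrm{Tr}_{\bar A_2}[W_R,\,I\otimes|\chi\rangle\langle\chi|]$. Expand $X\in\{J,D\}$ as $X=\sum_{l,m,n}p_{lmn}(X)\,P_l^{(A_1)}\otimes P_m^{(\bar A_1)}\otimes P_n^{(A_2)}$ in (generalized) Pauli bases with $P_0=I$ and $\mathrm{Tr}(P_\alpha^\dagger P_\beta)=\dim\cdot\delta_{\alpha\beta}$. Put $B_X=\sum_{m,n>0}|p_{0mn}(X)|^2$, $C_X=\sum_{l,n>0}|p_{l0n}(X)|^2$, $E_X=\sum_{l,m,n>0}|p_{lmn}(X)|^2$ and $$k_1=\tfrac{d^2}{2(d^2-1)}C_J,\quad k_2=\tfrac{d^2}{2(d^2-1)}C_D,\quad k_3=\tfrac{d^2\bar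 d^2}{2(d^2-1)(\bar d^2-1)}E_D,\quad k_4=\tfrac{d^2\bar d^2}{2(d^2-1)(\bar d^2-1)}E_J,\quad k_5=\tfrac{\bar d^2}{2(\bar d^2-1)}B_D .$$ **Statement.** 1. If a recovery $R$ maximizes $I_c$ over all pairs of local unitaries $(R_A,R_{\bar A})$ for every sufficiently small $\epsilon>0$, then $k_1(W_R)=0$. 2. If $R$ is optimal, then $k_1(W_R)=0$, and also $B_J=0$. 3. From every recovery $R$ an optimal one is obtained by a change $R_A^{(\epsilon)}\mapsto e^{i\epsilon O_A}R_A^{(\epsilon)}$, $R_{\bar A}^{(\epsilon)}\mapsto e^{i\epsilon O'_{\bar A}}R_{\bar A}^{(\epsilon)}$ for suitable Hermitian $O_A,O'_{\bar A}$. 4. If $\dim\mathcal H_{\bar A_2}=d_\chi$, then conversely every recovery with $k_1(W_R)=0$ and $B_J=0$ is optimal. 5. Every change as in 3 shifts $W_R$ to $W_R+O_A\otimes I_{\bar A}+I_A\otimes O'_{\bar A}$. 6. For any two recoveries, the coefficients $p_{lmn}(J)$ and $p_{lmn}(D)$ with $l,m>0$ coincide, and so do $k_2,k_3,k_4,k_5$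 (equivalently $C_D,E_D,E_J,B_D$). -/

import Mathlib

open Matrix Filter Topology
open scoped Kronecker

/-- The von Neumann entropy `-Tr ρ log ρ` (natural logarithm) of a Hermitian matrix, computed from
its eigenvalues; it is only used for density matrices. -/
noncomputable def vonNeumannEntropy {n : Type*} [Fintype n] [DecidableEq n]
    (ρ : Matrix n n ℂ) : ℝ :=
  open Classical in
  if h : ρ.IsHermitian then ∑ i, Real.negMulLog (h.eigenvalues i) else 0

/-- The density matrix `|Φ⟩⟨Φ|` of the maximally entangled state
`|Φ⟩ = d_L^{-1/2} ∑ i, |i⟩_L |i⟩_r` of `L` and an isomorphic reference `r`. -/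
noncomputable def maxEntangled (L : Type*) [Fintype L] [DecidableEq L] :
    Matrix (L × L) (L × L) ℂ :=
  Matrix.of fun p q => if p.1 = p.2 ∧ q.1 = q.2 then (Fintype.card L : ℂ)⁻¹ else 0

/-- `N ⊗ I_r` applied to an operator on `L ⊗ r`. -/
def applyLeft {L M r : Type*} (N : Matrix L L ℂ → Matrix M M ℂ)
    (X : Matrix (L × r) (L × r) ℂ) : Matrix (M × r) (M × r) ℂ :=
  Matrix.of fun p q => N (Matrix.of fun i j => X (i, p.2) (j, q.2)) p.1 q.1

/-- The partial trace over the second tensor factor. -/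
def traceRight {M r : Type*} [Fintype r] (X : Matrix (M × r) (M × r) ℂ) : Matrix M M ℂ :=
  Matrix.of fun i j => ∑ k, X (i, k) (j, k)

/-- The coherent information
`I_c(N) = S(Tr_r [(N ⊗ I_r)(|Φ⟩⟨Φ|)]) - S((N ⊗ I_r)(|Φ⟩⟨Φ|))` of a channel `N`. -/
noncomputable def coherentInformation {L M : Type*} [Fintype L] [DecidableEq L]
    [Fintype M] [DecidableEq M] (N : Matrix L L ℂ → Matrix M M ℂ) : ℝ :=
  vonNeumannEntropy (traceRight (applyLeft N (maxEntangled L)))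
    - vonNeumannEntropy (applyLeft N (maxEntangled L))

/-- An orthogonal operator basis of generalized Pauli type on a space with basis `ι`:
`P_0 = 1` and `Tr (P_α† P_β) = (dim) δ_{αβ}`, `0 ≤ α, β < (dim)²`. For Hermitian `P_α` (such as Pauli
strings) the normalization reads `Tr (P_α P_β) = (dim) δ_{αβ}`. -/
structure PauliBasis (ι : Type*) [Fintype ι] [DecidableEq ι] where
  op : Fin (Fintype.card ι ^ 2) → Matrix ι ι ℂ
  op_zero : ∀ α : Fin (Fintype.card ι ^ 2), (α : ℕ) = 0 → op α = 1
  orthogonal : ∀ α β, ((op α)ᴴ * op β).trace = if α = β then (Fintype.card ι : ℂ) else 0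

section Code

variable {a b a₂ b₂ : Type*} [Fintype a] [DecidableEq a] [Fintype b] [DecidableEq b]
  [Fintype a₂] [DecidableEq a₂] [Fintype b₂] [DecidableEq b₂]

/-- The isometry `|ψ⟩ ↦ |ψ⟩_{A₁Ā₁} |χ⟩_{A₂Ā₂}` from the logical space to `A Ā`, where
`A = A₁ A₂`, `Ā = Ā₁ Ā₂`; `a, b, a₂, b₂` index bases of `A₁, Ā₁, A₂, Ā₂`. -/
def attach (χ : a₂ × b₂ → ℂ) : Matrix ((a × a₂) × (b × b₂)) (a × b) ℂ :=
  Matrix.of fun p i => if p.1.1 = i.1 ∧ p.2.1 = i.2 then χ (p.1.2, p.2.2) else 0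

/-- The operator `I_{A₁Ā₁} ⊗ |χ⟩⟨χ|_{A₂Ā₂}` on `A Ā`. -/
def chiOp (χ : a₂ × b₂ → ℂ) : Matrix ((a × a₂) × (b × b₂)) ((a × a₂) × (b × b₂)) ℂ :=
  Matrix.of fun p q =>
    if p.1.1 = q.1.1 ∧ p.2.1 = q.2.1 then χ (p.1.2, p.2.2) * star (χ (q.1.2, q.2.2)) else 0

/-- The partial trace over `Ā₂`, leaving an operator on `A₁ Ā₁ A₂`. -/
def traceB₂ (X : Matrix ((a × a₂) × (b × b₂)) ((a × a₂) × (b × b₂)) ℂ) :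
    Matrix (a × b × a₂) (a × b × a₂) ℂ :=
  Matrix.of fun p q => ∑ m, X ((p.1, p.2.2), (p.2.1, m)) ((q.1, q.2.2), (q.2.1, m))

/-- The partial trace over `A₂ Ā₂`, leaving an operator on `A₁ Ā₁`. -/
def traceGeom (X : Matrix ((a × a₂) × (b × b₂)) ((a × a₂) × (b × b₂)) ℂ) :
    Matrix (a × b) (a × b) ℂ :=
  Matrix.of fun i j => ∑ k, ∑ m, X ((i.1, k), (i.2, m)) ((j.1, k), (j.2, m))

/-- An exact subsystem erasure-correcting code with complementary recovery:
`R_A R_Ā V |ψ⟩ = |ψ⟩_{A₁Ā₁} |χ⟩_{A₂Ā₂}` with local recovery unitaries, where the entanglement spectrum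
of the state `|χ⟩` is flat with Schmidt rank `d_χ = dim A₂`, that is, `Tr_{Ā₂} |χ⟩⟨χ| = I / d_χ`. -/
structure FlatExactCode (a b a₂ b₂ : Type*) [Fintype a] [DecidableEq a] [Fintype b] [DecidableEq b]
    [Fintype a₂] [DecidableEq a₂] [Fintype b₂] [DecidableEq b₂] where
  V : Matrix ((a × a₂) × (b × b₂)) (a × b) ℂ
  RA : Matrix (a × a₂) (a × a₂) ℂ
  RB : Matrix (b × b₂) (b × b₂) ℂ
  χ : a₂ × b₂ → ℂ
  RA_unitary : RA ∈ Matrix.unitaryGroup (a × a₂) ℂ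
  RB_unitary : RB ∈ Matrix.unitaryGroup (b × b₂) ℂ
  flat : traceRight (Matrix.vecMulVec χ (star χ)) = (Fintype.card a₂ : ℂ)⁻¹ • 1
  recovers : (RA ⊗ₖ RB) * V = attach χ

/-- The encode–recover channel `N_R(σ) = Tr_{A₂Ā₂} (R_A R_Ā V σ V† R_A† R_Ā†)`. -/
def recoveryChannel (V : Matrix ((a × a₂) × (b × b₂)) (a × b) ℂ)
    (RA : Matrix (a × a₂) (a × a₂) ℂ) (RB : Matrix (b × b₂) (b × b₂) ℂ)
    (σ : Matrix (a × b) (a × b) ℂ) : Matrix (a × b) (a × b) ℂ :=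
  traceGeom (((RA ⊗ₖ RB) * V) * σ * ((RA ⊗ₖ RB) * V)ᴴ)

/-- The skewing unitary `e^{iεX}`. -/
noncomputable def expI {n : Type*} [Fintype n] [DecidableEq n] (ε : ℝ) (X : Matrix n n ℂ) :
    Matrix n n ℂ :=
  NormedSpace.exp ((Complex.I * (ε : ℂ)) • X)

namespace FlatExactCode

variable (C : FlatExactCode a b a₂ b₂) (W : Matrix ((a × a₂) × (b × b₂)) ((a × a₂) × (b × b₂)) ℂ)

/-- The coherent information of the skewed code `V^{(ε)} = e^{iεW} V` with recovery unitaries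
`R_A`, `R_Ā`. -/
noncomputable def skewedIc (ε : ℝ) (RA : Matrix (a × a₂) (a × a₂) ℂ)
    (RB : Matrix (b × b₂) (b × b₂) ℂ) : ℝ :=
  coherentInformation (recoveryChannel (expI ε W * C.V) RA RB)

/-- A perturbative recovery: unitaries `R_A^{(ε)}`, `R_Ā^{(ε)}`, differentiable in `ε` at `0`, where
they are the recovery unitaries of the exact code. -/
structure RecoveryFamily (C : FlatExactCode a b a₂ b₂) where
  RA : ℝ → Matrix (a × a₂) (a × a₂) ℂ
  RB : ℝ → Matrix (b × b₂) (b × b₂) ℂ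
  RA_unitary : ∀ ε, RA ε ∈ Matrix.unitaryGroup (a × a₂) ℂ
  RB_unitary : ∀ ε, RB ε ∈ Matrix.unitaryGroup (b × b₂) ℂ
  RA_zero : RA 0 = C.RA
  RB_zero : RB 0 = C.RB
  RA_diff : ∀ i j, DifferentiableAt ℝ (fun ε => RA ε i j) 0
  RB_diff : ∀ i j, DifferentiableAt ℝ (fun ε => RB ε i j) 0

/-- `(R_A, R_Ā)` maximizes the coherent information of the skewed code at strength `ε` over all pairs
of local recovery unitaries. -/
def IsMaximizer (ε : ℝ) (RA : Matrix (a × a₂) (a × a₂) ℂ) (RB : Matrix (b × b₂) (b × b₂) ℂ) : Prop :=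
  ∀ SA ∈ Matrix.unitaryGroup (a × a₂) ℂ, ∀ SB ∈ Matrix.unitaryGroup (b × b₂) ℂ,
    C.skewedIc W ε SA SB ≤ C.skewedIc W ε RA RB

variable {C}

/-- The recovery maximizes the coherent information to leading order in `ε`. Deviations of the
coherent information from its value at `ε = 0` are of order `ε² log (1/ε)`. -/
def RecoveryFamily.IsOptimal (R : C.RecoveryFamily) : Prop :=
  ∀ S : C.RecoveryFamily, ∀ c > 0, ∀ᶠ ε in 𝓝[>] (0 : ℝ),
    C.skewedIc W ε (S.RA ε) (S.RB ε)
      ≤ C.skewedIc W ε (R.RA ε) (R.RB ε) + c * (ε ^ 2 * Real.log (1 / ε))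

/-- The effective unitary `R_A^{(ε)} R_Ā^{(ε)} e^{iεW} R_A^{(0)†} R_Ā^{(0)†}`. -/
noncomputable def RecoveryFamily.effective (R : C.RecoveryFamily) (ε : ℝ) :
    Matrix ((a × a₂) × (b × b₂)) ((a × a₂) × (b × b₂)) ℂ :=
  (R.RA ε ⊗ₖ R.RB ε) * expI ε W * (C.RA ⊗ₖ C.RB)ᴴ

/-- The operator `W_R`, defined at leading order by writing the effective unitary as
`e^{iεW_R} = 1 + iεW_R + o(ε)`. -/
noncomputable def RecoveryFamily.WR (R : C.RecoveryFamily) :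
    Matrix ((a × a₂) × (b × b₂)) ((a × a₂) × (b × b₂)) ℂ :=
  Matrix.of fun p q => -Complex.I * deriv (fun ε : ℝ => R.effective W ε p q) 0

end FlatExactCode

/-- `J = d_χ Tr_{Ā₂} {X, χ_{A₂Ā₂}}`. -/
def opJ (χ : a₂ × b₂ → ℂ) (X : Matrix ((a × a₂) × (b × b₂)) ((a × a₂) × (b × b₂)) ℂ) :
    Matrix (a × b × a₂) (a × b × a₂) ℂ :=
  (Fintype.card a₂ : ℂ) • traceB₂ (X * chiOp χ + chiOp χ * X)

/-- `D = i d_χ Tr_{Ā₂} [X, χ_{A₂Ā₂}]`. -/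
def opD (χ : a₂ × b₂ → ℂ) (X : Matrix ((a × a₂) × (b × b₂)) ((a × a₂) × (b × b₂)) ℂ) :
    Matrix (a × b × a₂) (a × b × a₂) ℂ :=
  (Complex.I * (Fintype.card a₂ : ℂ)) • traceB₂ (X * chiOp χ - chiOp χ * X)

/-- Generalized Pauli bases on `A₁`, `Ā₁` and `A₂`. -/
structure PauliBases (a b a₂ : Type*) [Fintype a] [DecidableEq a] [Fintype b] [DecidableEq b]
    [Fintype a₂] [DecidableEq a₂] where
  A : PauliBasis a
  B : PauliBasis b
  A₂ : PauliBasis a₂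

namespace PauliBases

variable (P : PauliBases a b a₂)

/-- The coefficient `p_{lmn}(X)` in `X = ∑ p_{lmn}(X) P_l ⊗ P_m ⊗ P_n`. -/
noncomputable def coeff (X : Matrix (a × b × a₂) (a × b × a₂) ℂ)
    (l : Fin (Fintype.card a ^ 2)) (m : Fin (Fintype.card b ^ 2))
    (n : Fin (Fintype.card a₂ ^ 2)) : ℂ :=
  ((P.A.op l ⊗ₖ (P.B.op m ⊗ₖ P.A₂.op n))ᴴ * X).trace
    / ((Fintype.card a : ℂ) * Fintype.card b * Fintype.card a₂)

/-- `∑_{m,n>0} |p_{0mn}(X)|²`. -/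
noncomputable def sectorB (X : Matrix (a × b × a₂) (a × b × a₂) ℂ) : ℝ :=
  ∑ l : Fin (Fintype.card a ^ 2), ∑ m : Fin (Fintype.card b ^ 2), ∑ n : Fin (Fintype.card a₂ ^ 2),
    if (l : ℕ) = 0 ∧ 0 < (m : ℕ) ∧ 0 < (n : ℕ) then ‖P.coeff X l m n‖ ^ 2 else 0

/-- `∑_{l,n>0} |p_{l0n}(X)|²`. -/
noncomputable def sectorC (X : Matrix (a × b × a₂) (a × b × a₂) ℂ) : ℝ :=
  ∑ l : Fin (Fintype.card a ^ 2), ∑ m : Fin (Fintype.card b ^ 2), ∑ n : Fin (Fintype.card a₂ ^ 2),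
    if 0 < (l : ℕ) ∧ (m : ℕ) = 0 ∧ 0 < (n : ℕ) then ‖P.coeff X l m n‖ ^ 2 else 0

/-- `∑_{l,m,n>0} |p_{lmn}(X)|²`. -/
noncomputable def sectorE (X : Matrix (a × b × a₂) (a × b × a₂) ℂ) : ℝ :=
  ∑ l : Fin (Fintype.card a ^ 2), ∑ m : Fin (Fintype.card b ^ 2), ∑ n : Fin (Fintype.card a₂ ^ 2),
    if 0 < (l : ℕ) ∧ 0 < (m : ℕ) ∧ 0 < (n : ℕ) then ‖P.coeff X l m n‖ ^ 2 else 0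

variable (χ : a₂ × b₂ → ℂ) (X : Matrix ((a × a₂) × (b × b₂)) ((a × a₂) × (b × b₂)) ℂ)

/-- `k₁ = d² C_J / (2 (d² - 1))`, with `d = dim A₁`. -/
noncomputable def k₁ : ℝ :=
  (Fintype.card a : ℝ) ^ 2 / (2 * ((Fintype.card a : ℝ) ^ 2 - 1)) * P.sectorC (opJ χ X)

/-- `k₂ = d² C_D / (2 (d² - 1))`. -/
noncomputable def k₂ : ℝ :=
  (Fintype.card a : ℝ) ^ 2 / (2 * ((Fintype.card a : ℝ) ^ 2 - 1)) * P.sectorC (opD χ X)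

/-- `k₃ = d² d̄² E_D / (2 (d² - 1) (d̄² - 1))`, with `d̄ = dim Ā₁`. -/
noncomputable def k₃ : ℝ :=
  (Fintype.card a : ℝ) ^ 2 * (Fintype.card b : ℝ) ^ 2
    / (2 * ((Fintype.card a : ℝ) ^ 2 - 1) * ((Fintype.card b : ℝ) ^ 2 - 1)) * P.sectorE (opD χ X)

/-- `k₄ = d² d̄² E_J / (2 (d² - 1) (d̄² - 1))`. -/
noncomputable def k₄ : ℝ :=
  (Fintype.card a : ℝ) ^ 2 * (Fintype.card b : ℝ) ^ 2
    / (2 * ((Fintype.card a : ℝ) ^ 2 - 1) * ((Fintype.card b : ℝ) ^ 2 - 1)) * P.sectorE (opJ χ X)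

/-- `k₅ = d̄² B_D / (2 (d̄² - 1))`. -/
noncomputable def k₅ : ℝ :=
  (Fintype.card b : ℝ) ^ 2 / (2 * ((Fintype.card b : ℝ) ^ 2 - 1)) * P.sectorB (opD χ X)

end PauliBases

end Code

/-! Purify the channel: with input `|Φ⟩`, the joint state of output and reference is `G Gᴴ / (d
d̄)`, where `G` is the Stinespring isometry read as a matrix from `A₂ Ā₂` to `A₁ Ā₁ r` (`regroup`).
At `ε = 0`, `G` is a product vector (maximally entangled state times `χ`), so this state is pure and
the output is maximally mixed.

The purity deficit of `G Gᴴ` is half the squared norm of the `2 × 2` minors of `G`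
(`sum_norm_sq_gram`). These vanish at `ε = 0`, so the deficit is quadratic in `ε`, with a
coefficient fixed by the first derivative, that is, by `leak χ W_R`. A state with deficit `q ε²` has
entropy `q ε² log (1/ε)` to leading order, whereas the output entropy stays within `O(ε²)` of its
maximum, without a logarithm. Hence `I_c = log (d d̄) - ‖leak W_R‖² / (2 d² d̄²) ε² log (1/ε)` up to
smaller terms (`tendsto_skewedIc`), and being optimal means minimizing `‖leak W_R‖`.

Changing the recovery adds to `W_R` an arbitrary `O_A ⊗ 1 + 1 ⊗ O_B` with Hermitian `O_A`, `O_B`.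
This is a least-squares problem over a real affine space: the minimum exists by orthogonal
projection and is characterized by orthogonality to the leaks of local operators
(`isOptimal_iff_isLeakStationary`). Tested on Pauli products, the orthogonality relations are the
vanishing of coefficients of `J`. Operators on `A` give the sector `C_J`. Since the spectrum of `χ`
is flat, every operator on `A₂` has a mirror on `Ā₂` with the same action on `χ`, so operators on
`Ā` give `B_J`. If `dim Ā₂ = d_χ`, mirroring also works in the other direction and there are no
further conditions.

The invariance statements are trace identities: local terms contribute nothing to `D`, and to `J`
only where `l = 0` or `m = 0`. -/

section LeadingOrder

open scoped ComplexOrder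

/-! ### Entropy of nearly uniform and nearly pure states. -/

section Entropy

variable {n : Type*} [Fintype n]

/-- Gibbs' inequality against the uniform distribution, with the collision probability as lower
bound. -/
theorem sum_negMulLog_near_uniform [Nonempty n] (p : n → ℝ) (h0 : ∀ i, 0 ≤ p i)
    (h1 : ∑ i, p i = 1) :
    Real.log (Fintype.card n) - (Fintype.card n * ∑ i, p i ^ 2 - 1) ≤ ∑ i, Real.negMulLog (p i) ∧
      ∑ i, Real.negMulLog (p i) ≤ Real.log (Fintype.card n) := by
  have hN : (0 : ℝ) < Fintype.card n := by exact_mod_cast Fintype.card_pos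
  set N : ℝ := (Fintype.card n : ℝ)
  constructor
  -- This is `log x ≤ x - 1` at `x = N p i`, multiplied by `p i`; the upper bound below uses `1 -
  -- x⁻¹ ≤ log x` at the same point.
  · have key : ∀ i, p i * Real.log N + p i - N * p i ^ 2 ≤ Real.negMulLog (p i) := by
      intro i
      rcases (h0 i).eq_or_lt with h | h
      · simp [← h]
      · have := Real.log_le_sub_one_of_pos (mul_pos hN h)
        rw [Real.log_mul hN.ne' h.ne'] at this
        unfold Real.negMulLog
        nlinarith
    have := Finset.sum_le_sum fun i (_ : i ∈ Finset.univ) => key i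
    simp only [Finset.sum_sub_distrib, Finset.sum_add_distrib, ← Finset.sum_mul, ← Finset.mul_sum,
      h1] at this
    linarith
  · have key : ∀ i, Real.negMulLog (p i) ≤ p i * Real.log N + (N⁻¹ - p i) := by
      intro i
      rcases (h0 i).eq_or_lt with h | h
      · simp [← h, hN.le]
      · have := Real.one_sub_inv_le_log_of_pos (mul_pos hN h)
        rw [Real.log_mul hN.ne' h.ne'] at this
        have h2 : p i * (N * p i)⁻¹ = N⁻¹ := by field_simp
        unfold Real.negMulLog
        nlinarith
    have := Finset.sum_le_sum fun i (_ : i ∈ Finset.univ) => key i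
    simp only [Finset.sum_sub_distrib, Finset.sum_add_distrib, ← Finset.sum_mul, h1,
      Finset.sum_const, Finset.card_univ, nsmul_eq_mul] at this
    have h3 : (Fintype.card n : ℝ) * N⁻¹ = 1 := mul_inv_cancel₀ hN.ne'
    rw [h3] at this
    linarith

/-- The Shannon entropy of a distribution of collision probability `1 - q` is governed by
`δ ≈ q / 2`, the weight outside its largest atom. -/
theorem sum_negMulLog_near_pure (p : n → ℝ) (h0 : ∀ i, 0 ≤ p i) (h1 : ∑ i, p i = 1) :
    ∃ δ : ℝ, (1 - ∑ i, p i ^ 2) / 2 ≤ δ ∧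
      δ ≤ (1 - ∑ i, p i ^ 2) / 2 + (1 - ∑ i, p i ^ 2) ^ 2 ∧
      Real.negMulLog δ ≤ ∑ i, Real.negMulLog (p i) ∧
      ∑ i, Real.negMulLog (p i) ≤ Real.negMulLog δ + δ * (Real.log (Fintype.card n) + 1) := by
  classical
  have hne : Nonempty n := by
    by_contra h
    rw [not_nonempty_iff] at h
    simp at h1
  have hN : (1 : ℝ) ≤ Fintype.card n := by exact_mod_cast Fintype.card_pos
  set N : ℝ := (Fintype.card n : ℝ) with hNdef
  obtain ⟨i₀, hmax⟩ := Finite.exists_max p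
  have hsplit : ∀ f : n → ℝ, ∑ i, f i = f i₀ + ∑ i ∈ Finset.univ.erase i₀, f i := fun f =>
    (Finset.add_sum_erase _ _ (Finset.mem_univ i₀)).symm
  set T := Finset.univ.erase i₀
  set δ := ∑ i ∈ T, p i with hδ
  have hp0 : p i₀ = 1 - δ := by
    have := hsplit p
    linarith
  have hδ0 : 0 ≤ δ := Finset.sum_nonneg fun i _ => h0 i
  have hle : ∀ i ∈ T, p i ≤ δ := fun i hi => Finset.single_le_sum (fun j _ => h0 j) hi
  have hsq0 : 0 ≤ ∑ i ∈ T, p i ^ 2 := Finset.sum_nonneg fun i _ => sq_nonneg _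
  have hsq1 : ∑ i ∈ T, p i ^ 2 ≤ δ ^ 2 := by
    calc ∑ i ∈ T, p i ^ 2 ≤ ∑ i ∈ T, p i * δ :=
          Finset.sum_le_sum fun i hi => by nlinarith [hle i hi, h0 i]
      _ = δ ^ 2 := by rw [← Finset.sum_mul]; ring
  have hS : ∑ i, p i ^ 2 = (1 - δ) ^ 2 + ∑ i ∈ T, p i ^ 2 := by rw [hsplit, hp0]
  have hcoll : ∑ i, p i ^ 2 ≤ 1 - δ := by
    calc ∑ i, p i ^ 2 ≤ ∑ i, p i * p i₀ :=
          Finset.sum_le_sum fun i _ => by nlinarith [hmax i, h0 i]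
      _ = 1 - δ := by rw [← Finset.sum_mul, h1, hp0, one_mul]
  -- With `q` the collision deficit, the split sum gives `2δ - 2δ² ≤ q ≤ 2δ - δ²`, and `hcoll` gives
  -- `δ ≤ q`; hence `q/2 ≤ δ ≤ q/2 + q²`.
  refine ⟨δ, by nlinarith, by nlinarith, ?_, ?_⟩
  · rw [hsplit]
    have hfirst : 0 ≤ Real.negMulLog (p i₀) :=
      Real.negMulLog_nonneg (h0 _) (by rw [hp0]; linarith)
    have : Real.negMulLog δ ≤ ∑ i ∈ T, Real.negMulLog (p i) := by
      have e : Real.negMulLog δ = ∑ i ∈ T, p i * (-Real.log δ) := by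
        rw [← Finset.sum_mul, Real.negMulLog]; ring
      rw [e]
      refine Finset.sum_le_sum fun i hi => ?_
      rcases (h0 i).eq_or_lt with h | h
      · simp [← h]
      · have := Real.log_le_log h (hle i hi)
        rw [Real.negMulLog]
        nlinarith
    linarith
  · rw [hsplit]
    have hfirst : Real.negMulLog (p i₀) ≤ δ := by
      have := Real.negMulLog_le_one_sub_self (h0 i₀)
      linarith
    have : ∑ i ∈ T, Real.negMulLog (p i) ≤ Real.negMulLog δ + δ * Real.log N := by
      rcases hδ0.eq_or_lt with h | h
      · have hz : ∀ i ∈ T, Real.negMulLog (p i) = 0 := fun i hi => by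
          have : p i = 0 := le_antisymm (by linarith [hle i hi]) (h0 i)
          simp [this]
        rw [Finset.sum_eq_zero hz, ← h]
        simp
      -- Gibbs' inequality against mass `δ` spread evenly over `N` atoms: `log x ≤ x - 1` at `x = δ
      -- / (N p i)`.
      · have key : ∀ i ∈ T, Real.negMulLog (p i) ≤
            p i * (Real.log N - Real.log δ) + (δ / N - p i) := by
          intro i _
          have hN0 : 0 < N := by linarith
          rcases (h0 i).eq_or_lt with hi | hi
          · simp only [← hi, Real.negMulLog_zero, zero_mul, sub_zero, zero_add]
            positivity
          · have h2 := Real.log_le_sub_one_of_pos (show 0 < δ / (N * p i) by positivity)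
            rw [Real.log_div h.ne' (by positivity), Real.log_mul hN0.ne' hi.ne'] at h2
            have h3 : p i * (δ / (N * p i)) = δ / N := by field_simp
            rw [Real.negMulLog]
            nlinarith
        have := Finset.sum_le_sum key
        simp only [Finset.sum_add_distrib, Finset.sum_sub_distrib, ← Finset.sum_mul,
          Finset.sum_const, nsmul_eq_mul, ← hδ] at this
        have hcard : (T.card : ℝ) * (δ / N) ≤ δ := by
          have h4 : (T.card : ℝ) ≤ N := by
            rw [hNdef]; exact_mod_cast Finset.card_le_univ T
          have h5 : (0:ℝ) < N := by linarith
          calc (T.card : ℝ) * (δ / N) ≤ N * (δ / N) := by gcongr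
            _ = δ := by field_simp
        rw [Real.negMulLog]
        linarith
    linarith

variable [DecidableEq n]

theorem Matrix.IsHermitian.trace_mul_self_eq_sum {ρ : Matrix n n ℂ} (h : ρ.IsHermitian) :
    (ρ * ρ).trace = ∑ i, ((h.eigenvalues i ^ 2 : ℝ) : ℂ) := by
  conv_lhs => rw [h.spectral_theorem, ← map_mul, Unitary.conjStarAlgAut_apply]
  rw [Matrix.trace_mul_cycle, Unitary.coe_star_mul_self, one_mul, diagonal_mul_diagonal,
    trace_diagonal]
  simp [sq]

theorem Matrix.IsHermitian.sum_eigenvalues_sq {ρ : Matrix n n ℂ} (h : ρ.IsHermitian) :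
    ∑ i, h.eigenvalues i ^ 2 = ∑ i, ∑ j, ‖ρ i j‖ ^ 2 := by
  have h1 := h.trace_mul_self_eq_sum
  have h2 : (ρ * ρ).trace = ((∑ i, ∑ j, ‖ρ i j‖ ^ 2 : ℝ) : ℂ) := by
    simp only [Matrix.trace, Matrix.diag_apply, Matrix.mul_apply]
    push_cast
    refine Finset.sum_congr rfl fun i _ => Finset.sum_congr rfl fun j _ => ?_
    rw [← h.apply j i, ← Complex.mul_conj']
    rfl
  rw [h2] at h1
  exact_mod_cast h1.symm

theorem Matrix.IsHermitian.sum_eigenvalues_eq_one {ρ : Matrix n n ℂ} (h : ρ.IsHermitian)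
    (ht : ρ.trace = 1) : ∑ i, h.eigenvalues i = 1 := by
  rw [h.trace_eq_sum_eigenvalues] at ht
  apply Complex.ofReal_injective
  push_cast
  exact ht

theorem vonNeumannEntropy_near_uniform [Nonempty n] {ρ : Matrix n n ℂ} (h : ρ.PosSemidef)
    (ht : ρ.trace = 1) :
    Real.log (Fintype.card n) - (Fintype.card n * ∑ i, ∑ j, ‖ρ i j‖ ^ 2 - 1)
        ≤ vonNeumannEntropy ρ ∧
      vonNeumannEntropy ρ ≤ Real.log (Fintype.card n) := by
  rw [vonNeumannEntropy, dif_pos h.1, ← h.1.sum_eigenvalues_sq]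
  convert sum_negMulLog_near_uniform _ h.eigenvalues_nonneg (h.1.sum_eigenvalues_eq_one ht)

theorem vonNeumannEntropy_near_pure {ρ : Matrix n n ℂ} (h : ρ.PosSemidef) (ht : ρ.trace = 1) :
    ∃ δ : ℝ, (1 - ∑ i, ∑ j, ‖ρ i j‖ ^ 2) / 2 ≤ δ ∧
      δ ≤ (1 - ∑ i, ∑ j, ‖ρ i j‖ ^ 2) / 2 + (1 - ∑ i, ∑ j, ‖ρ i j‖ ^ 2) ^ 2 ∧
      Real.negMulLog δ ≤ vonNeumannEntropy ρ ∧
      vonNeumannEntropy ρ ≤ Real.negMulLog δ + δ * (Real.log (Fintype.card n) + 1) := by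
  rw [vonNeumannEntropy, dif_pos h.1, ← h.1.sum_eigenvalues_sq]
  convert sum_negMulLog_near_pure _ h.eigenvalues_nonneg (h.1.sum_eigenvalues_eq_one ht)

theorem tendsto_log_one_div : Tendsto (fun ε : ℝ => Real.log (1 / ε)) (𝓝[>] 0) atTop := by
  simpa only [one_div, Function.comp_def] using
    Real.tendsto_log_atTop.comp tendsto_inv_nhdsGT_zero

theorem eventually_log_one_div_pos : ∀ᶠ ε : ℝ in 𝓝[>] 0, 0 < ε ∧ 0 < Real.log (1 / ε) :=
  (eventually_mem_nhdsWithin.mono fun _ h => h).and (tendsto_log_one_div.eventually_gt_atTop 0)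

/-- With `δ = ε² x`, `-δ log δ` splits into `2 x ε² log (1/ε)` and `-ε² x log x`. The second is
smaller by a logarithm, also when `q = 0`, because `negMulLog` is continuous at `0`. The factor `2`
is the exponent of `ε²`. -/
theorem tendsto_negMulLog_div {δ : ℝ → ℝ} {q : ℝ}
    (hδ : Tendsto (fun ε => δ ε / ε ^ 2) (𝓝[>] 0) (𝓝 q)) :
    Tendsto (fun ε => Real.negMulLog (δ ε) / (ε ^ 2 * Real.log (1 / ε))) (𝓝[>] 0)
      (𝓝 (2 * q)) := by
  have h1 : Tendsto (fun ε => 2 * (δ ε / ε ^ 2) +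
      Real.negMulLog (δ ε / ε ^ 2) / Real.log (1 / ε)) (𝓝[>] 0) (𝓝 (2 * q + 0)) :=
    (hδ.const_mul 2).add
      (((Real.continuous_negMulLog.tendsto q).comp hδ).div_atTop tendsto_log_one_div)
  rw [add_zero] at h1
  refine h1.congr' ?_
  filter_upwards [eventually_log_one_div_pos] with ε ⟨hε, hl⟩
  have e : δ ε = ε ^ 2 * (δ ε / ε ^ 2) := by field_simp
  have h2 : Real.negMulLog (ε ^ 2) = 2 * (ε ^ 2 * Real.log (1 / ε)) := by
    rw [Real.negMulLog, Real.log_pow, one_div, Real.log_inv]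
    push_cast
    ring
  conv_rhs => rw [e, Real.negMulLog_mul, h2]
  field_simp

/-- Entropy of a family of states whose purity deficit is `q ε² + o(ε²)`. -/
theorem tendsto_vonNeumannEntropy_near_pure {ρ : ℝ → Matrix n n ℂ} {q : ℝ}
    (h : ∀ ε, (ρ ε).PosSemidef) (ht : ∀ ε, (ρ ε).trace = 1)
    (hq : Tendsto (fun ε => (1 - ∑ i, ∑ j, ‖ρ ε i j‖ ^ 2) / ε ^ 2) (𝓝[>] 0) (𝓝 q)) :
    Tendsto (fun ε => vonNeumannEntropy (ρ ε) / (ε ^ 2 * Real.log (1 / ε))) (𝓝[>] 0) (𝓝 q) := by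
  choose δ h1 h2 h3 h4 using fun ε => vonNeumannEntropy_near_pure (h ε) (ht ε)
  have hε0 : Tendsto (fun ε : ℝ => ε ^ 2) (𝓝[>] 0) (𝓝 0) := by
    have : Tendsto (fun ε : ℝ => ε ^ 2) (𝓝 0) (𝓝 (0 ^ 2)) := (continuous_pow 2).tendsto 0
    rw [zero_pow two_ne_zero] at this
    exact this.mono_left nhdsWithin_le_nhds
  have hpos : ∀ᶠ ε : ℝ in 𝓝[>] 0, 0 < ε := eventually_mem_nhdsWithin
  -- The gap between the two bounds on `δ` is the squared deficit, of order `ε⁴`.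
  have hδ : Tendsto (fun ε => δ ε / ε ^ 2) (𝓝[>] 0) (𝓝 (q / 2)) := by
    have hu : Tendsto (fun ε => (1 - ∑ i, ∑ j, ‖ρ ε i j‖ ^ 2) / ε ^ 2 / 2 +
        ((1 - ∑ i, ∑ j, ‖ρ ε i j‖ ^ 2) / ε ^ 2) ^ 2 * ε ^ 2) (𝓝[>] 0)
        (𝓝 (q / 2 + q ^ 2 * 0)) := (hq.div_const 2).add ((hq.pow 2).mul hε0)
    rw [mul_zero, add_zero] at hu
    refine tendsto_of_tendsto_of_tendsto_of_le_of_le' (hq.div_const 2) hu ?_ ?_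
    · filter_upwards [hpos] with ε hε
      rw [div_right_comm]
      gcongr
      exact h1 ε
    · filter_upwards [hpos] with ε hε
      refine (div_le_div_of_nonneg_right (h2 ε) (sq_nonneg ε)).trans (le_of_eq ?_)
      field_simp
  have hmain := tendsto_negMulLog_div hδ
  rw [mul_div_cancel₀ q two_ne_zero] at hmain
  have hrest : Tendsto (fun ε => Real.negMulLog (δ ε) / (ε ^ 2 * Real.log (1 / ε)) +
      δ ε / ε ^ 2 * (Real.log (Fintype.card n) + 1) / Real.log (1 / ε)) (𝓝[>] 0) (𝓝 (q + 0)) :=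
    hmain.add ((hδ.mul_const _).div_atTop tendsto_log_one_div)
  rw [add_zero] at hrest
  refine tendsto_of_tendsto_of_tendsto_of_le_of_le' hmain hrest ?_ ?_
  · filter_upwards [eventually_log_one_div_pos] with ε ⟨hε, hl⟩
    gcongr
    exact h3 ε
  · filter_upwards [eventually_log_one_div_pos] with ε ⟨hε, hl⟩
    refine (div_le_div_of_nonneg_right (h4 ε) (by positivity)).trans (le_of_eq ?_)
    field_simp

/-- Entropy of a family of states at distance `O(ε)` from the maximally mixed state. -/
theorem tendsto_vonNeumannEntropy_near_uniform [Nonempty n] {ρ : ℝ → Matrix n n ℂ} {q : ℝ}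
    (h : ∀ ε, (ρ ε).PosSemidef) (ht : ∀ ε, (ρ ε).trace = 1)
    (hq : Tendsto (fun ε => (Fintype.card n * ∑ i, ∑ j, ‖ρ ε i j‖ ^ 2 - 1) / ε ^ 2)
      (𝓝[>] 0) (𝓝 q)) :
    Tendsto (fun ε => (vonNeumannEntropy (ρ ε) - Real.log (Fintype.card n)) /
      (ε ^ 2 * Real.log (1 / ε))) (𝓝[>] 0) (𝓝 0) := by
  -- Near the uniform state the entropy loss is `O(ε²)` without a logarithm, so it disappears on
  -- this scale.
  have hl0 := (hq.div_atTop tendsto_log_one_div).neg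
  rw [neg_zero] at hl0
  refine tendsto_of_tendsto_of_tendsto_of_le_of_le' hl0 tendsto_const_nhds ?_ ?_
  · filter_upwards [eventually_log_one_div_pos] with ε ⟨hε, hl⟩
    rw [div_div, ← neg_div]
    gcongr
    linarith [(vonNeumannEntropy_near_uniform (h ε) (ht ε)).1]
  · filter_upwards [eventually_log_one_div_pos] with ε ⟨hε, hl⟩
    refine div_nonpos_of_nonpos_of_nonneg ?_ (by positivity)
    linarith [(vonNeumannEntropy_near_uniform (h ε) (ht ε)).2]

end Entropy

/-! ### Minors as a measure of the distance from product vectors. -/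

section Minors

variable {m n : Type*}

/-- The `2 × 2` minors of a matrix; they vanish precisely on the product vectors. -/
def minors (G : Matrix m n ℂ) : EuclideanSpace ℂ ((m × m) × (n × n)) :=
  WithLp.toLp 2 fun x => G x.1.1 x.2.1 * G x.1.2 x.2.2 - G x.1.1 x.2.2 * G x.1.2 x.2.1

/-- The derivative of the `2 × 2` minors at `G`. -/
def tangentMinors (G : Matrix m n ℂ) :
    Matrix m n ℂ →ₗ[ℂ] EuclideanSpace ℂ ((m × m) × (n × n)) where
  toFun H := WithLp.toLp 2 fun x =>
    H x.1.1 x.2.1 * G x.1.2 x.2.2 + G x.1.1 x.2.1 * H x.1.2 x.2.2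
      - (H x.1.1 x.2.2 * G x.1.2 x.2.1 + G x.1.1 x.2.2 * H x.1.2 x.2.1)
  map_add' H K := by
    ext x
    simp only [Matrix.add_apply, PiLp.add_apply]
    ring
  map_smul' c H := by
    ext x
    simp only [Matrix.smul_apply, PiLp.smul_apply, smul_eq_mul, RingHom.id_apply]
    ring

theorem minors_vecMulVec (φ : m → ℂ) (χ : n → ℂ) : minors (vecMulVec φ χ) = 0 := by
  ext x
  simp only [minors, vecMulVec_apply, PiLp.zero_apply]
  ring

theorem tangentMinors_vecMulVec_right (φ u : m → ℂ) (χ : n → ℂ) :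
    tangentMinors (vecMulVec φ χ) (vecMulVec u χ) = 0 := by
  ext x
  simp only [tangentMinors, LinearMap.coe_mk, AddHom.coe_mk, vecMulVec_apply, PiLp.zero_apply]
  ring

theorem tangentMinors_vecMulVec_left (φ : m → ℂ) (χ v : n → ℂ) :
    tangentMinors (vecMulVec φ χ) (vecMulVec φ v) = 0 := by
  ext x
  simp only [tangentMinors, LinearMap.coe_mk, AddHom.coe_mk, vecMulVec_apply, PiLp.zero_apply]
  ring

variable [Fintype m] [Fintype n]

/-- Lagrange's identity. It expresses the purity deficit as the squared norm of a polynomial map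
that vanishes on product vectors, so that one derivative of `G` gives the deficit to second order.
-/
theorem sum_norm_sq_gram (G : Matrix m n ℂ) :
    (∑ i, ∑ k, ‖G i k‖ ^ 2) ^ 2 - ∑ i, ∑ j, ‖(G * Gᴴ) i j‖ ^ 2 = ‖minors G‖ ^ 2 / 2 := by
  have hz : ∀ z : ℂ, ((‖z‖ ^ 2 : ℝ) : ℂ) = z * star z := fun z => by
    push_cast
    exact (Complex.mul_conj' z).symm
  apply Complex.ofReal_injective
  rw [EuclideanSpace.norm_sq_eq]
  simp only [Complex.ofReal_sub, Complex.ofReal_div, Complex.ofReal_pow, Complex.ofReal_sum]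
  simp only [hz, ← Complex.ofReal_pow, Complex.ofReal_ofNat]
  rw [eq_div_iff two_ne_zero]
  simp only [minors, Fintype.sum_prod_type]
  have e1 : (∑ i, ∑ k, G i k * star (G i k)) ^ 2 =
      ∑ i, ∑ j, ∑ k, ∑ l, G i k * star (G i k) * (G j l * star (G j l)) := by
    rw [sq, Finset.sum_mul_sum]
    simp_rw [Finset.sum_mul_sum]
  have e2 : ∀ i j, (G * Gᴴ) i j * star ((G * Gᴴ) i j) =
      ∑ k, ∑ l, G i k * star (G j k) * (star (G i l) * G j l) := by
    intro i j
    simp only [Matrix.mul_apply, conjTranspose_apply, star_sum, star_mul', star_star]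
    rw [Finset.sum_mul_sum]
  -- The square of a minor has four terms; they pair up under exchange of `k` and `l`, which
  -- accounts for the factor `2`.
  have e3 : ∑ i, ∑ j, ∑ k, ∑ l, G i l * star (G i l) * (G j k * star (G j k)) =
      ∑ i, ∑ j, ∑ k, ∑ l, G i k * star (G i k) * (G j l * star (G j l)) :=
    Finset.sum_congr rfl fun i _ => Finset.sum_congr rfl fun j _ => Finset.sum_comm
  have e4 : ∑ i, ∑ j, ∑ k, ∑ l, G i l * star (G j l) * (star (G i k) * G j k) =
      ∑ i, ∑ j, ∑ k, ∑ l, G i k * star (G j k) * (star (G i l) * G j l) :=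
    Finset.sum_congr rfl fun i _ => Finset.sum_congr rfl fun j _ => Finset.sum_comm
  simp_rw [e2]
  rw [e1, mul_two]
  nth_rewrite 2 [← e3]
  nth_rewrite 2 [← e4]
  simp only [← Finset.sum_sub_distrib, ← Finset.sum_add_distrib]
  refine Finset.sum_congr rfl fun i _ => Finset.sum_congr rfl fun j _ =>
    Finset.sum_congr rfl fun k _ => Finset.sum_congr rfl fun l _ => ?_
  simp only [star_sub, star_mul']
  ring

/-- Variations orthogonal to both factors of a product vector change the minors isometrically, up to
scale, and independently of the other variations. -/
theorem inner_tangentMinors (φ z : m → ℂ) (χ v : n → ℂ) (H : Matrix m n ℂ)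
    (hz : star φ ⬝ᵥ z = 0) (hv : star χ ⬝ᵥ v = 0) :
    inner ℂ (tangentMinors (vecMulVec φ χ) (vecMulVec z v)) (tangentMinors (vecMulVec φ χ) H) =
      4 * (star φ ⬝ᵥ φ) * (star χ ⬝ᵥ χ) * ((vecMulVec z v)ᴴ * H).trace := by
  have hz' : ∑ i, star (z i) * φ i = 0 := by
    simpa [dotProduct, mul_comm] using congrArg star hz
  have hv' : ∑ i, star (v i) * χ i = 0 := by
    simpa [dotProduct, mul_comm] using congrArg star hv
  -- The tangent minor of `vecMulVec z v` factorizes and is antisymmetric under `i ↔ i'` and under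
  -- `k ↔ k'`. The four terms of the tangent minor of `H` therefore contribute equally, whence the
  -- constant `4`; orthogonality of `z` to `φ` and of `v` to `χ` removes the cross terms.
  let f : m → m → n → n → ℂ := fun i i' k k' =>
    star (z i * φ i' - φ i * z i') * star (v k * χ k' - χ k * v k') * (H i k * φ i' * χ k')
  have hf : ∑ i, ∑ i', ∑ k, ∑ k', f i i' k k' =
      (star φ ⬝ᵥ φ) * (star χ ⬝ᵥ χ) * ((vecMulVec z v)ᴴ * H).trace := by
    have h1 : ∀ i, ∑ i', star (z i * φ i' - φ i * z i') * φ i' =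
        star (z i) * (star φ ⬝ᵥ φ) := by
      intro i
      have : ∀ i', star (z i * φ i' - φ i * z i') * φ i' =
          star (z i) * (star (φ i') * φ i') - star (φ i) * (star (z i') * φ i') := by
        intro i'
        simp only [star_sub, star_mul']
        ring
      simp only [this, Finset.sum_sub_distrib, ← Finset.mul_sum, hz', mul_zero, sub_zero]
      rfl
    have h2 : ∀ k, ∑ k', star (v k * χ k' - χ k * v k') * χ k' =
        star (v k) * (star χ ⬝ᵥ χ) := by
      intro k
      have : ∀ k', star (v k * χ k' - χ k * v k') * χ k' =
          star (v k) * (star (χ k') * χ k') - star (χ k) * (star (v k') * χ k') := by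
        intro k'
        simp only [star_sub, star_mul']
        ring
      simp only [this, Finset.sum_sub_distrib, ← Finset.mul_sum, hv', mul_zero, sub_zero]
      rfl
    calc ∑ i, ∑ i', ∑ k, ∑ k', f i i' k k'
        = ∑ i, ∑ k, H i k * ((∑ i', star (z i * φ i' - φ i * z i') * φ i') *
            ∑ k', star (v k * χ k' - χ k * v k') * χ k') := by
          refine Finset.sum_congr rfl fun i _ => ?_
          rw [Finset.sum_comm]
          refine Finset.sum_congr rfl fun k _ => ?_
          rw [Finset.sum_mul_sum, Finset.mul_sum]
          refine Finset.sum_congr rfl fun i' _ => ?_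
          rw [Finset.mul_sum]
          refine Finset.sum_congr rfl fun k' _ => ?_
          simp only [f]
          ring
      _ = _ := by
          simp only [h1, h2, Matrix.trace, Matrix.diag_apply, Matrix.mul_apply,
            conjTranspose_apply, vecMulVec_apply, star_mul']
          rw [Finset.sum_comm, Finset.mul_sum]
          refine Finset.sum_congr rfl fun i _ => ?_
          rw [Finset.mul_sum]
          refine Finset.sum_congr rfl fun k _ => ?_
          ring
  have hsplit : inner ℂ (tangentMinors (vecMulVec φ χ) (vecMulVec z v))
      (tangentMinors (vecMulVec φ χ) H) =
      ∑ i, ∑ i', ∑ k, ∑ k', (f i i' k k' + f i' i k' k + (f i i' k' k + f i' i k k')) := by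
    rw [PiLp.inner_apply]
    simp only [Fintype.sum_prod_type, RCLike.inner_apply', tangentMinors, LinearMap.coe_mk,
      AddHom.coe_mk, vecMulVec_apply, f, starRingEnd_apply, star_sub, star_add, star_mul']
    refine Finset.sum_congr rfl fun i _ => Finset.sum_congr rfl fun j _ =>
      Finset.sum_congr rfl fun k _ => Finset.sum_congr rfl fun l _ => ?_
    ring
  have c1 : ∑ i, ∑ i', ∑ k, ∑ k', f i i' k' k = ∑ i, ∑ i', ∑ k, ∑ k', f i i' k k' :=
    Finset.sum_congr rfl fun i _ => Finset.sum_congr rfl fun j _ => Finset.sum_comm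
  have c2 : ∑ i, ∑ i', ∑ k, ∑ k', f i' i k k' = ∑ i, ∑ i', ∑ k, ∑ k', f i i' k k' :=
    Finset.sum_comm
  have c3 : ∑ i, ∑ i', ∑ k, ∑ k', f i' i k' k = ∑ i, ∑ i', ∑ k, ∑ k', f i i' k k' :=
    Finset.sum_comm.trans c1
  rw [hsplit]
  simp only [Finset.sum_add_distrib]
  rw [c1, c2, c3, hf]
  ring

end Minors

/-! ### Leakage into the environment. -/

section Code

set_option linter.unusedSectionVars false

variable {a b a₂ b₂ : Type*}

/-- Regard `M : L → A Ā` as a matrix from `A₂ Ā₂` to `A₁ Ā₁ r`, with `r` a copy of `L`. -/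
def regroup : Matrix ((a × a₂) × (b × b₂)) (a × b) ℂ →ₗ[ℂ]
    Matrix ((a × b) × (a × b)) (a₂ × b₂) ℂ where
  toFun M := Matrix.of fun q e => M ((q.1.1, e.1), (q.1.2, e.2)) q.2
  map_add' _ _ := rfl
  map_smul' _ _ := rfl

theorem regroup_apply (M : Matrix ((a × a₂) × (b × b₂)) (a × b) ℂ) (q : (a × b) × (a × b))
    (e : a₂ × b₂) : regroup M q e = M ((q.1.1, e.1), (q.1.2, e.2)) q.2 := rfl

/-- The matrix entries as a vector. -/
def flatten {l : Type*} (Z : Matrix l l ℂ) : l × l → ℂ := fun q => Z q.1 q.2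

theorem dotProduct_flatten_one {l : Type*} [Fintype l] [DecidableEq l] (Z : Matrix l l ℂ) :
    star (flatten 1) ⬝ᵥ flatten Z = Z.trace := by
  simp [dotProduct, flatten, Fintype.sum_prod_type, Matrix.one_apply, Matrix.trace, apply_ite]

variable [Fintype a] [Fintype b] [Fintype a₂] [Fintype b₂]

theorem sum_regroup (f : ((a × a₂) × (b × b₂)) → (a × b) → ℂ) :
    ∑ q : (a × b) × (a × b), ∑ e : a₂ × b₂, f ((q.1.1, e.1), (q.1.2, e.2)) q.2 =
      ∑ p, ∑ s, f p s := by
  rw [← Fintype.sum_prod_type', ← Fintype.sum_prod_type']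
  let e : ((a × b) × (a × b)) × (a₂ × b₂) ≃ ((a × a₂) × (b × b₂)) × (a × b) :=
    { toFun := fun x => (((x.1.1.1, x.2.1), (x.1.1.2, x.2.2)), x.1.2)
      invFun := fun x => (((x.1.1.1, x.1.2.1), x.2), (x.1.1.2, x.1.2.2))
      left_inv := fun _ => rfl
      right_inv := fun _ => rfl }
  exact Fintype.sum_equiv e _ _ fun _ => rfl

theorem trace_regroup (M N : Matrix ((a × a₂) × (b × b₂)) (a × b) ℂ) :
    ((regroup M)ᴴ * regroup N).trace = (Mᴴ * N).trace := by
  simp only [Matrix.trace, Matrix.diag_apply, Matrix.mul_apply, conjTranspose_apply, regroup_apply]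
  rw [Finset.sum_comm, sum_regroup fun p s => star (M p s) * N p s, Finset.sum_comm]

variable [DecidableEq a] [DecidableEq b]

/-- In the exact code the environment is in a product state with output and reference; `flatten 1`
is the unnormalized maximally entangled vector. -/
theorem regroup_attach (χ : a₂ × b₂ → ℂ) :
    regroup (attach χ) = vecMulVec (flatten (1 : Matrix (a × b) (a × b) ℂ)) χ := by
  ext q e
  simp [regroup_apply, attach, vecMulVec_apply, flatten, Matrix.one_apply, Prod.ext_iff]

/-- Product operators on `A Ā`. -/
def prodOp (F : Matrix a a ℂ) (G : Matrix a₂ a₂ ℂ) (E : Matrix b b ℂ) (G' : Matrix b₂ b₂ ℂ) :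
    Matrix ((a × a₂) × (b × b₂)) ((a × a₂) × (b × b₂)) ℂ := (F ⊗ₖ G) ⊗ₖ (E ⊗ₖ G')

theorem regroup_prodOp (χ : a₂ × b₂ → ℂ) (F : Matrix a a ℂ) (G : Matrix a₂ a₂ ℂ)
    (E : Matrix b b ℂ) (G' : Matrix b₂ b₂ ℂ) :
    regroup (prodOp F G E G' * (attach (a := a) (b := b) χ)) =
      vecMulVec (flatten (F ⊗ₖ E)) ((G ⊗ₖ G') *ᵥ χ) := by
  ext ⟨⟨i, j⟩, ⟨i', j'⟩⟩ ⟨k, m⟩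
  simp only [regroup_apply, vecMulVec_apply, flatten, kroneckerMap_apply, Matrix.mul_apply,
    mulVec, dotProduct, attach, prodOp, Fintype.sum_prod_type, Matrix.of_apply]
  rw [Finset.sum_eq_single i', Finset.mul_sum]
  · refine Finset.sum_congr rfl fun k' _ => ?_
    rw [Finset.sum_eq_single j', Finset.mul_sum]
    · refine Finset.sum_congr rfl fun m' _ => ?_
      simp only [and_self, if_true]
      ring
    · intro j'' _ hj
      simp [hj]
    · simp
  · intro i'' _ hi
    simp [hi]
  · simp

theorem chiOp_eq (χ : a₂ × b₂ → ℂ) :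
    chiOp (a := a) (b := b) χ =
      attach (a := a) (b := b) χ * (attach (a := a) (b := b) χ)ᴴ := by
  ext ⟨⟨i, k⟩, ⟨j, m⟩⟩ ⟨⟨i', k'⟩, ⟨j', m'⟩⟩
  simp only [chiOp, attach, Matrix.mul_apply, conjTranspose_apply, Matrix.of_apply]
  rw [Finset.sum_eq_single (i, j)]
  · by_cases h : i' = i ∧ j' = j
    · simp [h.1, h.2]
    · have h' : ¬ (i = i' ∧ j = j') := fun h1 => h ⟨h1.1.symm, h1.2.symm⟩
      simp [h, h']
  · rintro ⟨i'', j''⟩ _ h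
    have : ¬ (i = i'' ∧ j = j'') := fun h1 => h (by rw [h1.1, h1.2])
    simp [this]
  · simp

theorem chiOp_isHermitian (χ : a₂ × b₂ → ℂ) :
    (chiOp (a := a) (b := b) χ).IsHermitian := by
  rw [chiOp_eq]
  exact isHermitian_mul_conjTranspose_self _

theorem attach_isometry {χ : a₂ × b₂ → ℂ} (h : star χ ⬝ᵥ χ = 1) :
    (attach (a := a) (b := b) χ)ᴴ * (attach (a := a) (b := b) χ) = 1 := by
  ext ⟨i, j⟩ ⟨i', j'⟩
  simp only [attach, Matrix.mul_apply, conjTranspose_apply, Matrix.of_apply,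
    Fintype.sum_prod_type, Matrix.one_apply]
  rw [Finset.sum_eq_single i]
  · have e : ∀ k, ∑ x, ∑ m, star (if i = i ∧ x = j then χ (k, m) else 0) *
        (if i = i' ∧ x = j' then χ (k, m) else 0) =
        if (i, j) = (i', j') then ∑ m, star (χ (k, m)) * χ (k, m) else 0 := by
      intro k
      rw [Finset.sum_eq_single j]
      · by_cases h : i = i' ∧ j = j' <;> simp [h]
      · intro x _ hx
        simp [hx]
      · simp
    rw [Finset.sum_congr rfl fun k _ => e k]
    split_ifs
    · rw [← h]
      simp [dotProduct, Fintype.sum_prod_type]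
    · simp
  · intro x _ hx
    simp [hx]
  · simp

variable [DecidableEq a₂] [DecidableEq b₂]

/-- First-order change of the environment's Schmidt spectrum caused by `1 + iεX`. -/
def leak (χ : a₂ × b₂ → ℂ) : Matrix ((a × a₂) × (b × b₂)) ((a × a₂) × (b × b₂)) ℂ →ₗ[ℂ]
    EuclideanSpace ℂ ((((a × b) × (a × b)) × ((a × b) × (a × b))) ×
      ((a₂ × b₂) × (a₂ × b₂))) where
  toFun X := tangentMinors (regroup (attach (a := a) (b := b) χ))
    (regroup (X * attach (a := a) (b := b) χ))
  map_add' X Y := by rw [Matrix.add_mul, map_add, map_add]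
  map_smul' c X := by rw [Matrix.smul_mul, map_smul, map_smul, RingHom.id_apply]

theorem leak_apply (χ : a₂ × b₂ → ℂ)
    (X : Matrix ((a × a₂) × (b × b₂)) ((a × a₂) × (b × b₂)) ℂ) :
    leak χ X = tangentMinors (regroup (attach (a := a) (b := b) χ))
      (regroup (X * attach (a := a) (b := b) χ)) := rfl

/-- The environment factors enter only through their action on `χ`; this is what allows an operator
to be moved between `A₂` and `Ā₂`. -/
theorem leak_prodOp_congr {χ : a₂ × b₂ → ℂ} {G₁ G₂ : Matrix a₂ a₂ ℂ} {H₁ H₂ : Matrix b₂ b₂ ℂ}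
    (h : (G₁ ⊗ₖ H₁) *ᵥ χ = (G₂ ⊗ₖ H₂) *ᵥ χ) (F : Matrix a a ℂ) (E : Matrix b b ℂ) :
    leak χ (prodOp F G₁ E H₁) = leak χ (prodOp F G₂ E H₂) := by
  rw [leak_apply, leak_apply, regroup_prodOp, regroup_prodOp, h]

/-- Moving one factor of a product vector stays tangent to the product vectors. Hence neither `n =
0` nor, in `leak_env`, `l = m = 0` yields a condition. -/
theorem leak_geom (χ : a₂ × b₂ → ℂ) (F : Matrix a a ℂ) (E : Matrix b b ℂ) :
    leak χ (prodOp F 1 E 1) = 0 := by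
  rw [leak_apply, regroup_prodOp, regroup_attach, one_kronecker_one, one_mulVec,
    tangentMinors_vecMulVec_right]

theorem leak_env (χ : a₂ × b₂ → ℂ) (G : Matrix a₂ a₂ ℂ) (G' : Matrix b₂ b₂ ℂ) :
    leak χ (prodOp (1 : Matrix a a ℂ) G (1 : Matrix b b ℂ) G') = 0 := by
  rw [leak_apply, regroup_prodOp, regroup_attach, one_kronecker_one,
    tangentMinors_vecMulVec_left]

/-- The two hypotheses say that the varied factors are orthogonal to the maximally entangled vector
and to `χ`, as `inner_tangentMinors` requires. -/
theorem inner_leak_prodOp {χ : a₂ × b₂ → ℂ} (hχ : star χ ⬝ᵥ χ = 1) {F : Matrix a a ℂ}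
    {G : Matrix a₂ a₂ ℂ} {E : Matrix b b ℂ} {G' : Matrix b₂ b₂ ℂ}
    (hFE : F.trace * E.trace = 0) (hG : star χ ⬝ᵥ (G ⊗ₖ G') *ᵥ χ = 0)
    (X : Matrix ((a × a₂) × (b × b₂)) ((a × a₂) × (b × b₂)) ℂ) :
    inner ℂ (leak χ (prodOp F G E G')) (leak χ X) =
      4 * (Fintype.card (a × b) : ℂ) * ((prodOp F G E G')ᴴ * X *
        chiOp (a := a) (b := b) χ).trace := by
  have h1 := inner_tangentMinors (flatten (1 : Matrix (a × b) (a × b) ℂ)) (flatten (F ⊗ₖ E)) χ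
    ((G ⊗ₖ G') *ᵥ χ) (regroup (X * attach (a := a) (b := b) χ))
    (by rw [dotProduct_flatten_one, trace_kronecker, hFE]) hG
  rw [← regroup_prodOp, trace_regroup, dotProduct_flatten_one, hχ, ← regroup_attach,
    trace_one, mul_one, conjTranspose_mul] at h1
  rw [leak_apply, leak_apply, h1, chiOp_eq, Matrix.mul_assoc _ᴴ, Matrix.trace_mul_comm]
  simp only [Matrix.mul_assoc]

/-- The complex-linear extension of `Y ↦ 2 Re ⟨leak Y, leak X⟩` from Hermitian `Y`. -/
noncomputable def leakForm (χ : a₂ × b₂ → ℂ)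
    (X : Matrix ((a × a₂) × (b × b₂)) ((a × a₂) × (b × b₂)) ℂ) :
    Matrix ((a × a₂) × (b × b₂)) ((a × a₂) × (b × b₂)) ℂ →ₗ[ℂ] ℂ where
  toFun Y := inner ℂ (leak χ Yᴴ) (leak χ X) + inner ℂ (leak χ X) (leak χ Y)
  map_add' Y Z := by
    rw [conjTranspose_add, map_add, map_add, inner_add_left, inner_add_right]
    ring
  map_smul' c Y := by
    rw [conjTranspose_smul, map_smul, map_smul, inner_smul_left, inner_smul_right]
    simp only [starRingEnd_apply, star_star, RingHom.id_apply, smul_eq_mul]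
    ring

theorem leakForm_apply (χ : a₂ × b₂ → ℂ)
    (X Y : Matrix ((a × a₂) × (b × b₂)) ((a × a₂) × (b × b₂)) ℂ) :
    leakForm χ X Y = inner ℂ (leak χ Yᴴ) (leak χ X) + inner ℂ (leak χ X) (leak χ Y) := rfl

theorem leakForm_of_isHermitian (χ : a₂ × b₂ → ℂ)
    {X Y : Matrix ((a × a₂) × (b × b₂)) ((a × a₂) × (b × b₂)) ℂ} (hY : Y.IsHermitian) :
    leakForm χ X Y = ((2 * (inner ℂ (leak χ X) (leak χ Y)).re : ℝ) : ℂ) := by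
  rw [leakForm_apply, hY.eq, ← inner_conj_symm (leak χ Y), add_comm, Complex.add_conj]

theorem prodOp_conjTranspose (F : Matrix a a ℂ) (G : Matrix a₂ a₂ ℂ)
    (E : Matrix b b ℂ) (G' : Matrix b₂ b₂ ℂ) :
    (prodOp F G E G')ᴴ = prodOp Fᴴ Gᴴ Eᴴ G'ᴴ := by
  simp only [prodOp, conjTranspose_kronecker]

/-- The two inner products in `leakForm` produce the two orders of `X` and `χ`. Their sum is an
anticommutator, which is why stationarity constrains `J` and not `D`. -/
theorem leakForm_prodOp {χ : a₂ × b₂ → ℂ} (hχ : star χ ⬝ᵥ χ = 1) {F : Matrix a a ℂ}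
    {G : Matrix a₂ a₂ ℂ} {E : Matrix b b ℂ} {G' : Matrix b₂ b₂ ℂ}
    (hFE : F.trace * E.trace = 0) (hG : star χ ⬝ᵥ (G ⊗ₖ G') *ᵥ χ = 0)
    {X : Matrix ((a × a₂) × (b × b₂)) ((a × a₂) × (b × b₂)) ℂ} (hX : X.IsHermitian) :
    leakForm χ X (prodOp F G E G') = 4 * (Fintype.card (a × b) : ℂ) *
      (prodOp F G E G' *
        (X * chiOp (a := a) (b := b) χ + chiOp (a := a) (b := b) χ * X)).trace := by
  have hFE' : Fᴴ.trace * Eᴴ.trace = 0 := by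
    rw [trace_conjTranspose, trace_conjTranspose, ← star_mul', hFE, star_zero]
  have hG' : star χ ⬝ᵥ (Gᴴ ⊗ₖ G'ᴴ) *ᵥ χ = 0 := by
    rw [← conjTranspose_kronecker, dotProduct_mulVec, ← star_mulVec, star_dotProduct, hG,
      star_zero]
  rw [leakForm_apply, prodOp_conjTranspose, inner_leak_prodOp hχ hFE' hG',
    ← inner_conj_symm (leak χ X), inner_leak_prodOp hχ hFE hG]
  have h2 : star ((prodOp F G E G')ᴴ * X * (chiOp (a := a) (b := b) χ)).trace =
      (prodOp F G E G' * ((chiOp (a := a) (b := b) χ) * X)).trace := by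
    rw [← trace_conjTranspose, conjTranspose_mul, conjTranspose_mul, conjTranspose_conjTranspose,
      hX.eq, (chiOp_isHermitian χ).eq, ← Matrix.mul_assoc, Matrix.trace_mul_comm]
  rw [map_mul, starRingEnd_apply, starRingEnd_apply, h2, prodOp_conjTranspose]
  simp only [conjTranspose_conjTranspose, star_mul', star_ofNat, star_natCast, Matrix.mul_add,
    trace_add, Matrix.mul_assoc]
  ring

end Code

/-! ### Testing linear forms on Pauli bases. -/

section Pauli

variable {ι : Type*} [Fintype ι] [DecidableEq ι]

theorem Matrix.linearMap_eq_zero_of_isHermitian {n : Type*} {f : Matrix n n ℂ →ₗ[ℂ] ℂ}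
    (h : ∀ H : Matrix n n ℂ, H.IsHermitian → f H = 0) : f = 0 := by
  ext1 M
  rw [← realPart_add_I_smul_imaginaryPart M, map_add, map_smul, h _ (realPart M).2,
    h _ (imaginaryPart M).2]
  simp

namespace PauliBasis

variable (P : PauliBasis ι)

theorem linearIndependent_conjTranspose : LinearIndependent ℂ fun α => (P.op α)ᴴ := by
  rcases isEmpty_or_nonempty ι with hι | hι
  · have : IsEmpty (Fin (Fintype.card ι ^ 2)) := by
      rw [Fintype.card_eq_zero]
      exact Fin.isEmpty
    exact linearIndependent_empty_type
  rw [Fintype.linearIndependent_iff]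
  intro c hc β
  have h1 := congrArg (fun M => (M * P.op β).trace) hc
  simp only [Finset.sum_mul, trace_sum, Matrix.smul_mul, trace_smul, P.orthogonal, smul_eq_mul,
    mul_ite, mul_zero, Finset.sum_ite_eq', Finset.mem_univ, if_true,
    Matrix.zero_mul, trace_zero, mul_eq_zero, Nat.cast_eq_zero, Fintype.card_ne_zero,
    or_false] at h1
  exact h1

/-- There are `(dim)²` trace-orthogonal operators, hence they span. Adjoints are used because
`coeff` pairs with `Pᴴ`. -/
theorem linearMap_eq_zero {f : Matrix ι ι ℂ →ₗ[ℂ] ℂ} (h : ∀ α, f (P.op α)ᴴ = 0) : f = 0 := by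
  rcases isEmpty_or_nonempty ι with hι | hι
  · ext1 M
    rw [Subsingleton.elim M 0, map_zero, map_zero]
  have : NeZero (Fintype.card ι ^ 2) := ⟨by positivity⟩
  have hs := P.linearIndependent_conjTranspose.span_eq_top_of_card_eq_finrank
    (by rw [Fintype.card_fin, Module.finrank_matrix]; simp [sq])
  exact LinearMap.ext_on_range hs fun α => by rw [h, LinearMap.zero_apply]

theorem bilinear_eq_zero {κ : Type*} [Fintype κ] [DecidableEq κ] (Q : PauliBasis κ)
    {β : Matrix ι ι ℂ →ₗ[ℂ] Matrix κ κ ℂ →ₗ[ℂ] ℂ}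
    (h : ∀ α γ, β (P.op α)ᴴ (Q.op γ)ᴴ = 0) (F : Matrix ι ι ℂ) (G : Matrix κ κ ℂ) :
    β F G = 0 := by
  have h1 : ∀ α, β (P.op α)ᴴ = 0 := fun α => Q.linearMap_eq_zero (h α)
  have h2 : β.flip G = 0 := P.linearMap_eq_zero fun α => by
    rw [LinearMap.flip_apply, h1, LinearMap.zero_apply]
  exact DFunLike.congr_fun h2 F

theorem trace_conjTranspose_eq_zero {α : Fin (Fintype.card ι ^ 2)} (hα : 0 < (α : ℕ)) :
    (P.op α)ᴴ.trace = 0 := by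
  have h0 : 0 < Fintype.card ι ^ 2 := hα.trans α.2
  have h := P.orthogonal α ⟨0, h0⟩
  rw [P.op_zero ⟨0, h0⟩ rfl, mul_one, if_neg] at h
  · exact h
  · rintro rfl
    exact lt_irrefl _ hα

end PauliBasis

end Pauli

/-! ### Flat entanglement and mirrored operators. -/

section Code

set_option linter.unusedSectionVars false

variable {a b a₂ b₂ : Type*} [Fintype a] [DecidableEq a] [Fintype b] [DecidableEq b]
  [Fintype a₂] [DecidableEq a₂] [Fintype b₂] [DecidableEq b₂]

theorem kronecker_mulVec_apply (χ : a₂ × b₂ → ℂ) (G : Matrix a₂ a₂ ℂ) (G' : Matrix b₂ b₂ ℂ)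
    (k : a₂) (m : b₂) :
    ((G ⊗ₖ G') *ᵥ χ) (k, m) = (G * Matrix.of (Function.curry χ) * G'ᵀ) k m := by
  simp only [mulVec, dotProduct, Fintype.sum_prod_type, kroneckerMap_apply, Matrix.mul_apply,
    Matrix.of_apply, Function.curry_apply, transpose_apply, Finset.sum_mul]
  rw [Finset.sum_comm]
  refine Finset.sum_congr rfl fun m' _ => Finset.sum_congr rfl fun k' _ => ?_
  ring

/-- The partial trace is dual to tensoring with `1` on `Ā₂`. -/
theorem trace_mul_traceB₂ (F : Matrix a a ℂ) (E : Matrix b b ℂ) (G : Matrix a₂ a₂ ℂ)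
    (Y : Matrix ((a × a₂) × (b × b₂)) ((a × a₂) × (b × b₂)) ℂ) :
    ((F ⊗ₖ (E ⊗ₖ G)) * traceB₂ Y).trace = (prodOp F G E 1 * Y).trace := by
  have h1 : ((F ⊗ₖ (E ⊗ₖ G)) * traceB₂ Y).trace = ∑ p : a × b × a₂, ∑ q : a × b × a₂, ∑ m : b₂,
      F p.1 q.1 * (E p.2.1 q.2.1 * G p.2.2 q.2.2) *
        Y ((q.1, q.2.2), (q.2.1, m)) ((p.1, p.2.2), (p.2.1, m)) := by
    simp only [Matrix.trace, Matrix.diag_apply, Matrix.mul_apply, traceB₂, Matrix.of_apply,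
      kroneckerMap_apply, Finset.mul_sum]
  let e : (a × b × a₂) × b₂ ≃ (a × a₂) × (b × b₂) :=
    { toFun := fun x => ((x.1.1, x.1.2.2), (x.1.2.1, x.2))
      invFun := fun x => ((x.1.1, x.2.1, x.1.2), x.2.2)
      left_inv := fun _ => rfl
      right_inv := fun _ => rfl }
  have h2 : ∀ f : ((a × a₂) × (b × b₂)) → ℂ,
      ∑ x, f x = ∑ p : a × b × a₂, ∑ m : b₂, f ((p.1, p.2.2), (p.2.1, m)) := fun f => by
    rw [← Fintype.sum_prod_type']
    exact (Fintype.sum_equiv e _ _ fun _ => rfl).symm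
  rw [h1]
  simp only [Matrix.trace, Matrix.diag_apply, Matrix.mul_apply, prodOp, kroneckerMap_apply]
  rw [h2]
  refine Finset.sum_congr rfl fun p _ => ?_
  rw [Finset.sum_comm]
  refine Finset.sum_congr rfl fun m _ => ?_
  rw [h2]
  refine Finset.sum_congr rfl fun q _ => ?_
  rw [Finset.sum_eq_single m]
  · simp only [one_apply_eq]
    ring
  · intro m' _ hm
    simp [one_apply_ne' hm]
  · simp

theorem trace_mul_opJ (χ : a₂ × b₂ → ℂ) (F : Matrix a a ℂ) (E : Matrix b b ℂ)
    (G : Matrix a₂ a₂ ℂ) (X : Matrix ((a × a₂) × (b × b₂)) ((a × a₂) × (b × b₂)) ℂ) :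
    ((F ⊗ₖ (E ⊗ₖ G)) * opJ χ X).trace =
      (Fintype.card a₂ : ℂ) * (prodOp F G E 1 * (X * chiOp χ + chiOp χ * X)).trace := by
  rw [opJ, Matrix.mul_smul, trace_smul, trace_mul_traceB₂, smul_eq_mul]

namespace FlatExactCode

variable (C : FlatExactCode a b a₂ b₂)

/-- The coefficients of `|χ⟩` as a matrix. -/
def schmidt : Matrix a₂ b₂ ℂ := Matrix.of (Function.curry C.χ)

theorem sum_flat (k k' : a₂) : ∑ m, C.χ (k, m) * star (C.χ (k', m)) =
    if k = k' then (Fintype.card a₂ : ℂ)⁻¹ else 0 := by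
  have := congrFun (congrFun C.flat k) k'
  simpa [traceRight, vecMulVec_apply, Matrix.one_apply] using this

/-- Flatness makes `√d_χ · schmidt` a coisometry; all mirroring rests on this. -/
theorem schmidt_mul_conjTranspose :
    C.schmidt * C.schmidtᴴ = (Fintype.card a₂ : ℂ)⁻¹ • 1 := by
  ext k k'
  simp only [schmidt, Matrix.mul_apply, conjTranspose_apply, Matrix.of_apply, Function.curry_apply,
    C.sum_flat, Matrix.smul_apply, one_apply, smul_eq_mul, mul_ite, mul_one, mul_zero]

theorem dotProduct_kronecker_one (G : Matrix a₂ a₂ ℂ) :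
    star C.χ ⬝ᵥ (G ⊗ₖ (1 : Matrix b₂ b₂ ℂ)) *ᵥ C.χ = (Fintype.card a₂ : ℂ)⁻¹ * G.trace := by
  have h1 : star C.χ ⬝ᵥ (G ⊗ₖ (1 : Matrix b₂ b₂ ℂ)) *ᵥ C.χ =
      ((G * C.schmidt) * C.schmidtᴴ).trace := by
    simp only [dotProduct, Fintype.sum_prod_type, kronecker_mulVec_apply, transpose_one,
      Matrix.mul_one, Matrix.trace, Matrix.diag_apply]
    refine Finset.sum_congr rfl fun k _ => ?_
    rw [Matrix.mul_apply (M := G * C.schmidt)]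
    exact Finset.sum_congr rfl fun m _ => mul_comm _ _
  rw [h1, Matrix.mul_assoc, C.schmidt_mul_conjTranspose, Matrix.mul_smul, Matrix.mul_one,
    trace_smul, smul_eq_mul]

theorem star_dotProduct_self [Nonempty a₂] : star C.χ ⬝ᵥ C.χ = 1 := by
  have h := C.dotProduct_kronecker_one 1
  rwa [one_kronecker_one, one_mulVec, trace_one, inv_mul_cancel₀] at h
  exact_mod_cast Fintype.card_ne_zero

/-- The operator on `Ā₂` that acts on `|χ⟩` as `G` does on `A₂`. -/
noncomputable def mirror (G : Matrix a₂ a₂ ℂ) : Matrix b₂ b₂ ℂ :=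
  ((Fintype.card a₂ : ℂ) • (C.schmidtᴴ * G * C.schmidt))ᵀ

theorem mirror_conjTranspose (G : Matrix a₂ a₂ ℂ) : (C.mirror G)ᴴ = C.mirror Gᴴ := by
  have h : ∀ M : Matrix b₂ b₂ ℂ, Mᵀᴴ = Mᴴᵀ := fun _ => rfl
  rw [mirror, mirror, h, conjTranspose_smul, conjTranspose_mul,
    conjTranspose_mul, conjTranspose_conjTranspose, star_natCast, Matrix.mul_assoc]

/-- Writing `χ` as the matrix `S = schmidt`, an operator on `Ā₂` multiplies from the right, and `S
(d_χ Sᴴ G S) = G S` by the coisometry relation. -/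
theorem mirror_mulVec [Nonempty a₂] (G : Matrix a₂ a₂ ℂ) :
    ((1 : Matrix a₂ a₂ ℂ) ⊗ₖ C.mirror G) *ᵥ C.χ = (G ⊗ₖ (1 : Matrix b₂ b₂ ℂ)) *ᵥ C.χ := by
  have hd : (Fintype.card a₂ : ℂ) ≠ 0 := by exact_mod_cast Fintype.card_ne_zero
  ext ⟨k, m⟩
  rw [kronecker_mulVec_apply, kronecker_mulVec_apply, mirror, transpose_transpose,
    transpose_one, Matrix.mul_one, Matrix.one_mul, Matrix.mul_smul, Matrix.mul_assoc C.schmidtᴴ,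
    ← Matrix.mul_assoc]
  change ((Fintype.card a₂ : ℂ) • (C.schmidt * C.schmidtᴴ * (G * C.schmidt))) k m = _
  rw [C.schmidt_mul_conjTranspose, Matrix.smul_mul, Matrix.one_mul, smul_smul,
    mul_inv_cancel₀ hd, one_smul]
  rfl

/-- In equal dimensions the coisometry is unitary and mirroring can be inverted. A larger `Ā₂` has
operators that move `χ` to vectors out of reach from `A₂`. The adjoint relation is included because
`leakForm` evaluates `leak` on `Yᴴ` too. -/
theorem exists_mulVec_eq [Nonempty a₂] (hcard : Fintype.card b₂ = Fintype.card a₂)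
    (G' : Matrix b₂ b₂ ℂ) : ∃ G : Matrix a₂ a₂ ℂ,
    ((1 : Matrix a₂ a₂ ℂ) ⊗ₖ G') *ᵥ C.χ = (G ⊗ₖ (1 : Matrix b₂ b₂ ℂ)) *ᵥ C.χ ∧
    ((1 : Matrix a₂ a₂ ℂ) ⊗ₖ G'ᴴ) *ᵥ C.χ = (Gᴴ ⊗ₖ (1 : Matrix b₂ b₂ ℂ)) *ᵥ C.χ := by
  have hd : (Fintype.card a₂ : ℂ) ≠ 0 := by exact_mod_cast Fintype.card_ne_zero
  have h1 : ((Fintype.card a₂ : ℂ) • C.schmidt) * C.schmidtᴴ = 1 := by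
    rw [Matrix.smul_mul, C.schmidt_mul_conjTranspose, smul_smul, mul_inv_cancel₀ hd, one_smul]
  have h2 : C.schmidtᴴ * ((Fintype.card a₂ : ℂ) • C.schmidt) = 1 :=
    (mul_eq_one_comm_of_card_eq _ _ _ hcard.symm).1 h1
  have key : ∀ H : Matrix b₂ b₂ ℂ, ((1 : Matrix a₂ a₂ ℂ) ⊗ₖ H) *ᵥ C.χ =
      (((Fintype.card a₂ : ℂ) • (C.schmidt * Hᵀ * C.schmidtᴴ)) ⊗ₖ (1 : Matrix b₂ b₂ ℂ)) *ᵥ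
        C.χ := by
    intro H
    ext ⟨k, m⟩
    rw [kronecker_mulVec_apply, kronecker_mulVec_apply, transpose_one, Matrix.mul_one,
      Matrix.one_mul]
    change (C.schmidt * Hᵀ) k m =
      (((Fintype.card a₂ : ℂ) • (C.schmidt * Hᵀ * C.schmidtᴴ)) * C.schmidt) k m
    rw [Matrix.smul_mul, ← Matrix.mul_smul, Matrix.mul_assoc _ C.schmidtᴴ, h2, Matrix.mul_one]
  refine ⟨_, key G', ?_⟩
  rw [key, conjTranspose_smul, conjTranspose_mul, conjTranspose_mul, conjTranspose_conjTranspose,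
    star_natCast, Matrix.mul_assoc C.schmidt]
  rfl

end FlatExactCode

end Code

/-! ### Stationarity in terms of the coefficients of `J`. -/

section Code

set_option linter.unusedSectionVars false

theorem Matrix.linearMap_eq_zero_of_kronecker {m n : Type*} [Fintype m] [DecidableEq m]
    [Fintype n] [DecidableEq n] {f : Matrix (m × n) (m × n) ℂ →ₗ[ℂ] ℂ}
    (h : ∀ (F : Matrix m m ℂ) (G : Matrix n n ℂ), f (F ⊗ₖ G) = 0) : f = 0 := by
  apply Matrix.ext_linearMap
  rintro ⟨i, k⟩ ⟨j, l⟩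
  ext
  have := h (Matrix.single i j 1) (Matrix.single k l 1)
  rw [single_kronecker_single, mul_one] at this
  simpa using this

variable {a b a₂ b₂ : Type*} [Fintype a] [DecidableEq a] [Fintype b] [DecidableEq b]
  [Fintype a₂] [DecidableEq a₂] [Fintype b₂] [DecidableEq b₂]

/-- `O ↦ O ⊗ I`. -/
def kroneckerOne (m n : Type*) [DecidableEq n] :
    Matrix m m ℂ →ₗ[ℂ] Matrix (m × n) (m × n) ℂ where
  toFun O := O ⊗ₖ 1
  map_add' _ _ := add_kronecker _ _ _
  map_smul' _ _ := smul_kronecker _ _ _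

/-- `O ↦ I ⊗ O`. -/
def oneKronecker (m n : Type*) [DecidableEq m] :
    Matrix n n ℂ →ₗ[ℂ] Matrix (m × n) (m × n) ℂ where
  toFun O := 1 ⊗ₖ O
  map_add' _ _ := kronecker_add _ _ _
  map_smul' _ _ := kronecker_smul _ _ _

theorem Matrix.IsHermitian.kronecker_one {m : Type*} (n : Type*) [DecidableEq n]
    {O : Matrix m m ℂ} (h : O.IsHermitian) : (O ⊗ₖ (1 : Matrix n n ℂ)).IsHermitian := by
  rw [Matrix.IsHermitian, conjTranspose_kronecker, h.eq, conjTranspose_one]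

theorem Matrix.IsHermitian.one_kronecker (m : Type*) {n : Type*} [DecidableEq m]
    {O : Matrix n n ℂ} (h : O.IsHermitian) : ((1 : Matrix m m ℂ) ⊗ₖ O).IsHermitian := by
  rw [Matrix.IsHermitian, conjTranspose_kronecker, h.eq, conjTranspose_one]

/-- Stationarity of `‖leak X‖²` under local Hermitian changes of `X`. -/
def IsLeakStationary (χ : a₂ × b₂ → ℂ)
    (X : Matrix ((a × a₂) × (b × b₂)) ((a × a₂) × (b × b₂)) ℂ) : Prop :=
  ∀ (OA : Matrix (a × a₂) (a × a₂) ℂ) (OB : Matrix (b × b₂) (b × b₂) ℂ), OA.IsHermitian →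
    OB.IsHermitian → (inner ℂ (leak χ X) (leak χ (OA ⊗ₖ 1 + 1 ⊗ₖ OB))).re = 0

/-- On Hermitian arguments `leakForm` is twice the real inner product, and a complex-linear form is
determined by its values there; so the real condition becomes a complex-linear one, testable on
non-Hermitian Pauli operators. -/
theorem isLeakStationary_iff {χ : a₂ × b₂ → ℂ}
    {X : Matrix ((a × a₂) × (b × b₂)) ((a × a₂) × (b × b₂)) ℂ} :
    IsLeakStationary χ X ↔
      (∀ O : Matrix (a × a₂) (a × a₂) ℂ, leakForm χ X (O ⊗ₖ 1) = 0) ∧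
      (∀ O : Matrix (b × b₂) (b × b₂) ℂ, leakForm χ X (1 ⊗ₖ O) = 0) := by
  constructor
  · intro h
    constructor
    · refine DFunLike.congr_fun (f := (leakForm χ X).comp (kroneckerOne _ _)) (g := 0)
        (linearMap_eq_zero_of_isHermitian fun H hH => ?_)
      have h1 := h H 0 hH isHermitian_zero
      rw [kronecker_zero, add_zero] at h1
      change leakForm χ X (H ⊗ₖ 1) = 0
      rw [leakForm_of_isHermitian χ (hH.kronecker_one _), h1]
      simp
    · refine DFunLike.congr_fun (f := (leakForm χ X).comp (oneKronecker _ _)) (g := 0)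
        (linearMap_eq_zero_of_isHermitian fun H hH => ?_)
      have h1 := h 0 H isHermitian_zero hH
      rw [zero_kronecker, zero_add] at h1
      change leakForm χ X (1 ⊗ₖ H) = 0
      rw [leakForm_of_isHermitian χ (hH.one_kronecker _), h1]
      simp
  · rintro ⟨hA, hB⟩ OA OB hOA hOB
    have h1 := leakForm_of_isHermitian χ (X := X)
      ((hOA.kronecker_one (b × b₂)).add (hOB.one_kronecker (a × a₂)))
    rw [map_add, hA, hB, add_zero] at h1
    have h2 := Complex.ofReal_injective (h1.symm.trans Complex.ofReal_zero.symm)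
    linarith

theorem leakForm_congr {χ : a₂ × b₂ → ℂ}
    (X : Matrix ((a × a₂) × (b × b₂)) ((a × a₂) × (b × b₂)) ℂ)
    {Y Z : Matrix ((a × a₂) × (b × b₂)) ((a × a₂) × (b × b₂)) ℂ}
    (h : leak χ Y = leak χ Z) (h' : leak χ Yᴴ = leak χ Zᴴ) : leakForm χ X Y = leakForm χ X Z := by
  rw [leakForm_apply, leakForm_apply, h, h']

theorem leakForm_eq_zero {χ : a₂ × b₂ → ℂ}
    (X : Matrix ((a × a₂) × (b × b₂)) ((a × a₂) × (b × b₂)) ℂ)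
    {Y : Matrix ((a × a₂) × (b × b₂)) ((a × a₂) × (b × b₂)) ℂ}
    (h : leak χ Y = 0) (h' : leak χ Yᴴ = 0) : leakForm χ X Y = 0 := by
  rw [leakForm_apply, h, h', inner_zero_left, inner_zero_right, add_zero]

theorem leakForm_geom (χ : a₂ × b₂ → ℂ)
    (X : Matrix ((a × a₂) × (b × b₂)) ((a × a₂) × (b × b₂)) ℂ) (F : Matrix a a ℂ)
    (E : Matrix b b ℂ) : leakForm χ X (prodOp F 1 E 1) = 0 :=
  leakForm_eq_zero X (leak_geom _ _ _) (by
    rw [prodOp_conjTranspose, conjTranspose_one, conjTranspose_one, leak_geom])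

theorem leakForm_env (χ : a₂ × b₂ → ℂ)
    (X : Matrix ((a × a₂) × (b × b₂)) ((a × a₂) × (b × b₂)) ℂ) (G : Matrix a₂ a₂ ℂ)
    (G' : Matrix b₂ b₂ ℂ) : leakForm χ X (prodOp 1 G 1 G') = 0 :=
  leakForm_eq_zero X (leak_env _ _ _) (by
    rw [prodOp_conjTranspose, conjTranspose_one, conjTranspose_one, leak_env])

namespace FlatExactCode

variable (C : FlatExactCode a b a₂ b₂)

/-- By flatness the expectation of `G ⊗ 1` in `χ` is the normalized trace of `G`, so a traceless `G`
gives the orthogonality needed in `leakForm_prodOp`. -/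
theorem leakForm_eq_trace_opJ [Nonempty a₂] {F : Matrix a a ℂ} {E : Matrix b b ℂ}
    {G : Matrix a₂ a₂ ℂ} (hFE : F.trace * E.trace = 0) (hG : G.trace = 0)
    {X : Matrix ((a × a₂) × (b × b₂)) ((a × a₂) × (b × b₂)) ℂ} (hX : X.IsHermitian) :
    (Fintype.card a₂ : ℂ) * leakForm C.χ X (prodOp F G E 1) = 4 * (Fintype.card (a × b) : ℂ) *
      ((F ⊗ₖ (E ⊗ₖ G)) * opJ C.χ X).trace := by
  rw [leakForm_prodOp C.star_dotProduct_self hFE (by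
    rw [C.dotProduct_kronecker_one, hG, mul_zero]) hX, trace_mul_opJ]
  ring

end FlatExactCode

namespace PauliBases

variable (P : PauliBases a b a₂)

theorem sectorB_eq_zero_iff (X : Matrix (a × b × a₂) (a × b × a₂) ℂ) :
    P.sectorB X = 0 ↔ ∀ (l : Fin (Fintype.card a ^ 2)) (m : Fin (Fintype.card b ^ 2))
      (n : Fin (Fintype.card a₂ ^ 2)),
      (l : ℕ) = 0 → 0 < (m : ℕ) → 0 < (n : ℕ) →
      P.coeff X l m n = 0 := by
  have h0 : ∀ (l : Fin (Fintype.card a ^ 2)) (m : Fin (Fintype.card b ^ 2))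
      (n : Fin (Fintype.card a₂ ^ 2)), 0 ≤ if (l : ℕ) = 0 ∧ 0 < (m : ℕ) ∧ 0 < (n : ℕ) then
      ‖P.coeff X l m n‖ ^ 2 else 0 := fun l m n => by positivity
  rw [sectorB, Fintype.sum_eq_zero_iff_of_nonneg fun l =>
    Finset.sum_nonneg fun m _ => Finset.sum_nonneg fun n _ => h0 l m n]
  simp only [funext_iff, Pi.zero_apply]
  refine forall_congr' fun l => ?_
  rw [Fintype.sum_eq_zero_iff_of_nonneg fun m => Finset.sum_nonneg fun n _ => h0 l m n]
  simp only [funext_iff, Pi.zero_apply]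
  refine forall_congr' fun m => ?_
  rw [Fintype.sum_eq_zero_iff_of_nonneg fun n => h0 l m n]
  simp only [funext_iff, Pi.zero_apply]
  refine forall_congr' fun n => ?_
  simp only [ite_eq_right_iff, and_imp, sq_eq_zero_iff, norm_eq_zero]

theorem sectorC_eq_zero_iff (X : Matrix (a × b × a₂) (a × b × a₂) ℂ) :
    P.sectorC X = 0 ↔ ∀ (l : Fin (Fintype.card a ^ 2)) (m : Fin (Fintype.card b ^ 2))
      (n : Fin (Fintype.card a₂ ^ 2)),
      0 < (l : ℕ) → (m : ℕ) = 0 → 0 < (n : ℕ) →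
      P.coeff X l m n = 0 := by
  have h0 : ∀ (l : Fin (Fintype.card a ^ 2)) (m : Fin (Fintype.card b ^ 2))
      (n : Fin (Fintype.card a₂ ^ 2)), 0 ≤ if 0 < (l : ℕ) ∧ (m : ℕ) = 0 ∧ 0 < (n : ℕ) then
      ‖P.coeff X l m n‖ ^ 2 else 0 := fun l m n => by positivity
  rw [sectorC, Fintype.sum_eq_zero_iff_of_nonneg fun l =>
    Finset.sum_nonneg fun m _ => Finset.sum_nonneg fun n _ => h0 l m n]
  simp only [funext_iff, Pi.zero_apply]
  refine forall_congr' fun l => ?_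
  rw [Fintype.sum_eq_zero_iff_of_nonneg fun m => Finset.sum_nonneg fun n _ => h0 l m n]
  simp only [funext_iff, Pi.zero_apply]
  refine forall_congr' fun m => ?_
  rw [Fintype.sum_eq_zero_iff_of_nonneg fun n => h0 l m n]
  simp only [funext_iff, Pi.zero_apply]
  refine forall_congr' fun n => ?_
  simp only [ite_eq_right_iff, and_imp, sq_eq_zero_iff, norm_eq_zero]

/-- For `d = 1` the denominator is `0`, and division by zero would make `k₁` vanish identically. -/
theorem k₁_eq_zero_iff (ha : 2 ≤ Fintype.card a) (χ : a₂ × b₂ → ℂ)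
    (X : Matrix ((a × a₂) × (b × b₂)) ((a × a₂) × (b × b₂)) ℂ) :
    P.k₁ χ X = 0 ↔ P.sectorC (opJ χ X) = 0 := by
  have h : (2 : ℝ) ≤ Fintype.card a := by exact_mod_cast ha
  have h1 : (Fintype.card a : ℝ) ^ 2 / (2 * ((Fintype.card a : ℝ) ^ 2 - 1)) ≠ 0 := by
    apply ne_of_gt
    have : (0 : ℝ) < (Fintype.card a : ℝ) ^ 2 - 1 := by nlinarith
    positivity
  rw [k₁, mul_eq_zero, or_iff_right h1]

theorem coeff_eq_zero_iff [Nonempty a] [Nonempty b] [Nonempty a₂] (C : FlatExactCode a b a₂ b₂)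
    {X : Matrix ((a × a₂) × (b × b₂)) ((a × a₂) × (b × b₂)) ℂ} (hX : X.IsHermitian)
    {l : Fin (Fintype.card a ^ 2)} {m : Fin (Fintype.card b ^ 2)} {n : Fin (Fintype.card a₂ ^ 2)}
    (hlm : 0 < (l : ℕ) ∨ 0 < (m : ℕ)) (hn : 0 < (n : ℕ)) :
    P.coeff (opJ C.χ X) l m n = 0 ↔
      leakForm C.χ X (prodOp (P.A.op l)ᴴ (P.A₂.op n)ᴴ (P.B.op m)ᴴ 1) = 0 := by
  have h1 := C.leakForm_eq_trace_opJ (F := (P.A.op l)ᴴ) (E := (P.B.op m)ᴴ) (G := (P.A₂.op n)ᴴ)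
    (by rcases hlm with h | h
        · rw [P.A.trace_conjTranspose_eq_zero h, zero_mul]
        · rw [P.B.trace_conjTranspose_eq_zero h, mul_zero])
    (P.A₂.trace_conjTranspose_eq_zero hn) hX
  have d0 : (Fintype.card a : ℂ) ≠ 0 := by exact_mod_cast Fintype.card_ne_zero
  have d1 : (Fintype.card b : ℂ) ≠ 0 := by exact_mod_cast Fintype.card_ne_zero
  have d2 : (Fintype.card a₂ : ℂ) ≠ 0 := by exact_mod_cast Fintype.card_ne_zero
  rw [← mul_eq_zero_iff_left d2 (b := leakForm C.χ X _), h1, coeff,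
    conjTranspose_kronecker, conjTranspose_kronecker,
    Fintype.card_prod]
  push_cast
  simp [d0, d1, d2]

/-- Stationarity kills the sectors `C_J` and `B_J`. -/
theorem sectors_eq_zero_of_isLeakStationary [Nonempty a] [Nonempty b] [Nonempty a₂]
    (C : FlatExactCode a b a₂ b₂)
    {X : Matrix ((a × a₂) × (b × b₂)) ((a × a₂) × (b × b₂)) ℂ} (hX : X.IsHermitian)
    (h : IsLeakStationary C.χ X) : P.sectorC (opJ C.χ X) = 0 ∧ P.sectorB (opJ C.χ X) = 0 := by
  obtain ⟨hA, hB⟩ := isLeakStationary_iff.1 h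
  rw [sectorB_eq_zero_iff, sectorC_eq_zero_iff]
  constructor
  · intro l m n hl hm hn
    rw [P.coeff_eq_zero_iff C hX (Or.inl hl) hn, P.B.op_zero m hm, conjTranspose_one, prodOp,
      one_kronecker_one, hA]
  · intro l m n hl hm hn
    rw [P.coeff_eq_zero_iff C hX (Or.inr hm) hn, P.A.op_zero l hl, conjTranspose_one]
    -- The operator acts on `Ā₁ A₂`, which is not local; its mirror image acts on `Ā` alone.
    rw [leakForm_congr X (leak_prodOp_congr (C.mirror_mulVec (P.A₂.op n)ᴴ).symm _ _)]
    · rw [prodOp, one_kronecker_one, hB]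
    · rw [prodOp_conjTranspose, prodOp_conjTranspose, C.mirror_conjTranspose, conjTranspose_one,
        conjTranspose_one, conjTranspose_one]
      exact leak_prodOp_congr (C.mirror_mulVec _).symm _ _

/-- For `dim Ā₂ = dim A₂` the vanishing of `C_J` and `B_J` implies stationarity. -/
theorem isLeakStationary_of_sectors_eq_zero [Nonempty a] [Nonempty b] [Nonempty a₂]
    (C : FlatExactCode a b a₂ b₂) (hcard : Fintype.card b₂ = Fintype.card a₂)
    {X : Matrix ((a × a₂) × (b × b₂)) ((a × a₂) × (b × b₂)) ℂ} (hX : X.IsHermitian)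
    (hC : P.sectorC (opJ C.χ X) = 0) (hB : P.sectorB (opJ C.χ X) = 0) :
    IsLeakStationary C.χ X := by
  rw [sectorB_eq_zero_iff] at hB
  rw [sectorC_eq_zero_iff] at hC
  have hn : ∀ n : Fin (Fintype.card a₂ ^ 2), (P.A₂.op n)ᴴ = 1 ∨ 0 < (n : ℕ) := fun n => by
    rcases Nat.eq_zero_or_pos (n : ℕ) with h | h
    · exact Or.inl (by rw [P.A₂.op_zero n h, conjTranspose_one])
    · exact Or.inr h
  -- The cases `n = 0` and `l = 0` hold for every `X`; only `l, n > 0` uses the sector `C_J`.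
  have hAop : ∀ l n, leakForm C.χ X (prodOp (P.A.op l)ᴴ (P.A₂.op n)ᴴ 1 1) = 0 := by
    intro l n
    rcases hn n with h2 | h2
    · rw [h2, leakForm_geom]
    rcases Nat.eq_zero_or_pos (l : ℕ) with h1 | h1
    · rw [P.A.op_zero l h1, conjTranspose_one, leakForm_env]
    · have h0 := (P.coeff_eq_zero_iff C hX (Or.inl h1) h2).1
        (hC l ⟨0, by positivity⟩ n h1 rfl h2)
      rwa [P.B.op_zero _ rfl, conjTranspose_one] at h0
  have hBop : ∀ m n, leakForm C.χ X (prodOp 1 (P.A₂.op n)ᴴ (P.B.op m)ᴴ 1) = 0 := by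
    intro m n
    rcases hn n with h2 | h2
    · rw [h2, leakForm_geom]
    rcases Nat.eq_zero_or_pos (m : ℕ) with h1 | h1
    · rw [P.B.op_zero m h1, conjTranspose_one, leakForm_env]
    · have h0 := (P.coeff_eq_zero_iff C hX (Or.inr h1) h2).1
        (hB ⟨0, by positivity⟩ m n rfl h1 h2)
      rwa [P.A.op_zero _ rfl, conjTranspose_one] at h0
  have hA' : ∀ (F : Matrix a a ℂ) (G : Matrix a₂ a₂ ℂ), leakForm C.χ X (prodOp F G 1 1) = 0 :=
    P.A.bilinear_eq_zero P.A₂ (β := LinearMap.mk₂ ℂ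
      (fun F G => leakForm C.χ X (prodOp F G 1 1))
      (fun _ _ _ => by simp only [prodOp, add_kronecker, map_add])
      (fun _ _ _ => by simp only [prodOp, smul_kronecker, map_smul])
      (fun _ _ _ => by simp only [prodOp, kronecker_add, add_kronecker, map_add])
      (fun _ _ _ => by simp only [prodOp, kronecker_smul, smul_kronecker, map_smul])) hAop
  have hB' : ∀ (E : Matrix b b ℂ) (G : Matrix a₂ a₂ ℂ), leakForm C.χ X (prodOp 1 G E 1) = 0 :=
    P.B.bilinear_eq_zero P.A₂ (β := LinearMap.mk₂ ℂ
      (fun E G => leakForm C.χ X (prodOp 1 G E 1))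
      (fun _ _ _ => by simp only [prodOp, kronecker_add, add_kronecker, map_add])
      (fun _ _ _ => by simp only [prodOp, kronecker_smul, smul_kronecker, map_smul])
      (fun _ _ _ => by simp only [prodOp, kronecker_add, add_kronecker, map_add])
      (fun _ _ _ => by simp only [prodOp, kronecker_smul, smul_kronecker, map_smul])) hBop
  refine isLeakStationary_iff.2 ⟨?_, ?_⟩
  · refine DFunLike.congr_fun (f := (leakForm C.χ X).comp (kroneckerOne _ _)) (g := 0)
      (linearMap_eq_zero_of_kronecker fun F G => ?_)
    have := hA' F G
    rwa [prodOp, one_kronecker_one] at this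
  · refine DFunLike.congr_fun (f := (leakForm C.χ X).comp (oneKronecker _ _)) (g := 0)
      (linearMap_eq_zero_of_kronecker fun E G' => ?_)
    obtain ⟨G, hG, hG'⟩ := C.exists_mulVec_eq hcard G'
    have h1 : leakForm C.χ X (prodOp 1 1 E G') = 0 := by
      rw [leakForm_congr X (leak_prodOp_congr hG _ _), hB']
      rw [prodOp_conjTranspose, prodOp_conjTranspose, conjTranspose_one, conjTranspose_one,
        conjTranspose_one]
      exact leak_prodOp_congr hG' _ _
    rwa [prodOp, one_kronecker_one] at h1

end PauliBases

end Code

/-! ### Differentiable matrix families and second-order limits. -/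

section Derivative

/-- `f` is entrywise differentiable at `0` with derivative `f'`. -/
def HasEntryDeriv {m n : Type*} (f : ℝ → Matrix m n ℂ) (f' : Matrix m n ℂ) : Prop :=
  ∀ i j, HasDerivAt (fun ε => f ε i j) (f' i j) 0

namespace HasEntryDeriv

variable {l m n p : Type*}

theorem const (A : Matrix m n ℂ) : HasEntryDeriv (fun _ => A) 0 :=
  fun i j => hasDerivAt_const 0 (A i j)

theorem mul [Fintype m] {f : ℝ → Matrix l m ℂ} {g : ℝ → Matrix m n ℂ} {f' : Matrix l m ℂ}
    {g' : Matrix m n ℂ} (hf : HasEntryDeriv f f') (hg : HasEntryDeriv g g') :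
    HasEntryDeriv (fun ε => f ε * g ε) (f' * g 0 + f 0 * g') := by
  intro i j
  simp only [Matrix.mul_apply, Matrix.add_apply, ← Finset.sum_add_distrib]
  exact HasDerivAt.fun_sum fun k _ => (hf i k).mul (hg k j)

theorem kronecker {f : ℝ → Matrix l m ℂ} {g : ℝ → Matrix n p ℂ} {f' : Matrix l m ℂ}
    {g' : Matrix n p ℂ} (hf : HasEntryDeriv f f') (hg : HasEntryDeriv g g') :
    HasEntryDeriv (fun ε => f ε ⊗ₖ g ε) (f' ⊗ₖ g 0 + f 0 ⊗ₖ g') := fun i j =>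
  (hf i.1 j.1).mul (hg i.2 j.2)

theorem conjTranspose {f : ℝ → Matrix m n ℂ} {f' : Matrix m n ℂ} (hf : HasEntryDeriv f f') :
    HasEntryDeriv (fun ε => (f ε)ᴴ) f'ᴴ := fun i j => (hf j i).star

theorem unique {f : ℝ → Matrix m n ℂ} {f' f'' : Matrix m n ℂ} (h : HasEntryDeriv f f')
    (h' : HasEntryDeriv f f'') : f' = f'' := by
  ext i j
  exact (h i j).unique (h' i j)

open scoped Matrix.Norms.Operator in
theorem expI [Fintype n] [DecidableEq n] (W : Matrix n n ℂ) :
    HasEntryDeriv (fun ε => expI ε W) (Complex.I • W) := by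
  have h := hasDerivAt_exp_smul_const (𝕂 := ℝ) (Complex.I • W) 0
  rw [zero_smul, NormedSpace.exp_zero, one_mul] at h
  intro i j
  have h2 := ((Matrix.entryLinearMap ℝ ℂ i j).toContinuousLinearMap.hasFDerivAt).comp_hasDerivAt
    (0 : ℝ) h
  refine (h2.congr_of_eventuallyEq (Eventually.of_forall fun ε => ?_))
  change _root_.expI ε W i j = NormedSpace.exp (ε • Complex.I • W) i j
  have e : ε • Complex.I • W = (Complex.I * (ε : ℂ)) • W := by
    rw [mul_comm, mul_smul]
    rfl
  rw [_root_.expI, e]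

end HasEntryDeriv

variable {n : Type*} [Fintype n] [DecidableEq n]

theorem expI_zero (W : Matrix n n ℂ) : expI 0 W = 1 := by
  simp [expI, NormedSpace.exp_zero]

theorem expI_mem_unitary {W : Matrix n n ℂ} (hW : W.IsHermitian) (ε : ℝ) :
    expI ε W ∈ Matrix.unitaryGroup n ℂ := by
  rw [Matrix.mem_unitaryGroup_iff, star_eq_conjTranspose, expI, ← exp_conjTranspose,
    conjTranspose_smul, hW.eq, ← Matrix.exp_add_of_commute, ← add_smul]
  · simp
  · exact ((Commute.refl W).smul_left _).smul_right _

/-- The generator of a differentiable family of unitaries is Hermitian. -/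
theorem exists_generator {f : ℝ → Matrix n n ℂ} (hu : ∀ ε, f ε ∈ Matrix.unitaryGroup n ℂ)
    (hd : ∀ i j, DifferentiableAt ℝ (fun ε => f ε i j) 0) :
    ∃ O : Matrix n n ℂ, O.IsHermitian ∧ HasEntryDeriv f (Complex.I • (O * f 0)) := by
  have h1 : HasEntryDeriv f (Matrix.of fun i j => deriv (fun ε => f ε i j) 0) :=
    fun i j => (hd i j).hasDerivAt
  set f' : Matrix n n ℂ := Matrix.of fun i j => deriv (fun ε => f ε i j) 0
  have h2 := h1.mul h1.conjTranspose
  -- Differentiating `f fᴴ = 1` shows that `f' (f 0)ᴴ` is anti-Hermitian; `-i` times it is the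
  -- generator.
  have e : (fun ε => f ε * (f ε)ᴴ) = fun _ => 1 :=
    funext fun ε => Matrix.mem_unitaryGroup_iff.1 (hu ε)
  rw [e] at h2
  have h3 : f' * (f 0)ᴴ + f 0 * f'ᴴ = 0 := h2.unique (HasEntryDeriv.const 1)
  refine ⟨-Complex.I • (f' * (f 0)ᴴ), ?_, ?_⟩
  · rw [Matrix.IsHermitian, conjTranspose_smul, conjTranspose_mul, conjTranspose_conjTranspose,
      eq_neg_of_add_eq_zero_right h3]
    simp
  · have h4 : (f 0)ᴴ * f 0 = 1 := Matrix.mem_unitaryGroup_iff'.1 (hu 0)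
    rw [Matrix.smul_mul, Matrix.mul_assoc, h4, Matrix.mul_one, smul_smul]
    simpa using h1

theorem tendsto_norm_sq_div {f : ℝ → ℂ} {f' : ℂ} (h : HasDerivAt f f' 0) (h0 : f 0 = 0) :
    Tendsto (fun ε => ‖f ε‖ ^ 2 / ε ^ 2) (𝓝[>] 0) (𝓝 (‖f'‖ ^ 2)) := by
  have h1 := (hasDerivAt_iff_tendsto_slope_zero.1 h).mono_left
    (nhdsWithin_mono 0 fun x (hx : 0 < x) => hx.ne')
  refine (h1.norm.pow 2).congr fun ε => ?_
  rw [zero_add, h0, sub_zero, norm_smul, mul_pow, norm_inv, Real.norm_eq_abs, inv_pow, sq_abs,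
    inv_mul_eq_div]

/-- Since the minors vanish at `0`, no second derivative is needed; this is why recoveries need only
be differentiable at `0`. -/
theorem tendsto_minors {m k : Type*} [Fintype m] [Fintype k] {G : ℝ → Matrix m k ℂ}
    {G' : Matrix m k ℂ} (h : HasEntryDeriv G G') (h0 : minors (G 0) = 0) :
    Tendsto (fun ε => ‖minors (G ε)‖ ^ 2 / ε ^ 2) (𝓝[>] 0)
      (𝓝 (‖tangentMinors (G 0) G'‖ ^ 2)) := by
  simp only [EuclideanSpace.norm_sq_eq, Finset.sum_div]
  refine tendsto_finsetSum _ fun x _ => tendsto_norm_sq_div ?_ ?_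
  · exact ((h _ _).mul (h _ _)).sub ((h _ _).mul (h _ _))
  · rw [h0]
    rfl

/-- The variance identity: the collision excess is a squared distance from the uniform state, hence
quadratic in a first-order deviation. -/
theorem sum_norm_sub_uniform [Nonempty n] {ρ : Matrix n n ℂ} (ht : ρ.trace = 1) :
    (Fintype.card n : ℝ) * ∑ i, ∑ j, ‖ρ i j‖ ^ 2 - 1 = Fintype.card n *
      ∑ i, ∑ j, ‖ρ i j - ((Fintype.card n : ℂ)⁻¹ • (1 : Matrix n n ℂ)) i j‖ ^ 2 := by
  have hN : (Fintype.card n : ℝ) ≠ 0 := by exact_mod_cast Fintype.card_ne_zero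
  have hc : (Fintype.card n : ℂ)⁻¹ = (((Fintype.card n : ℝ)⁻¹ : ℝ) : ℂ) := by push_cast; rfl
  rw [hc]
  set N : ℝ := (Fintype.card n : ℝ)
  have h1 : ∀ i j, ‖ρ i j - (((N⁻¹ : ℝ) : ℂ) • (1 : Matrix n n ℂ)) i j‖ ^ 2 =
      ‖ρ i j‖ ^ 2 - if i = j then 2 * N⁻¹ * (ρ i i).re - N⁻¹ ^ 2 else 0 := by
    intro i j
    rw [Matrix.smul_apply, Matrix.one_apply, smul_eq_mul]
    split_ifs with h
    · subst h
      rw [mul_one, ← Complex.normSq_eq_norm_sq, ← Complex.normSq_eq_norm_sq,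
        Complex.normSq_apply, Complex.normSq_apply, Complex.sub_re, Complex.sub_im,
        Complex.ofReal_re, Complex.ofReal_im]
      ring
    · simp
  have h2 : ∑ i, (ρ i i).re = 1 := by
    have := congrArg Complex.re ht
    simpa [Matrix.trace] using this
  simp only [h1, Finset.sum_sub_distrib, Finset.sum_ite_eq, Finset.mem_univ, if_true,
    ← Finset.mul_sum, h2, Finset.sum_const, Finset.card_univ, nsmul_eq_mul]
  change N * _ - 1 = N * (_ - (2 * N⁻¹ * 1 - N * N⁻¹ ^ 2))
  field_simp
  ring

end Derivative

/-! ### Leading-order coherent information. -/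

section Code

set_option linter.unusedSectionVars false

theorem Matrix.PosSemidef.traceRight {M r : Type*} [Finite M] [Fintype r]
    {X : Matrix (M × r) (M × r) ℂ} (h : X.PosSemidef) : (traceRight X).PosSemidef := by
  have e : _root_.traceRight X = ∑ k, X.submatrix (fun i => (i, k)) (fun i => (i, k)) := by
    ext i j
    simp [_root_.traceRight, Matrix.sum_apply]
  rw [e]
  exact Matrix.posSemidef_sum _ fun k _ => h.submatrix _

theorem trace_traceRight {M r : Type*} [Fintype M] [Fintype r] (X : Matrix (M × r) (M × r) ℂ) :
    (traceRight X).trace = X.trace := by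
  simp [traceRight, Matrix.trace, Fintype.sum_prod_type]

variable {a b a₂ b₂ : Type*} [Fintype a] [DecidableEq a] [Fintype b] [DecidableEq b]
  [Fintype a₂] [DecidableEq a₂] [Fintype b₂] [DecidableEq b₂]

/-- The blocks of `|Φ⟩⟨Φ|` are multiples of matrix units, and tracing out `A₂ Ā₂` is the sum over
the columns of `regroup M`. -/
theorem applyLeft_maxEntangled (M : Matrix ((a × a₂) × (b × b₂)) (a × b) ℂ) :
    applyLeft (fun σ : Matrix (a × b) (a × b) ℂ => traceGeom (M * σ * Mᴴ))
      (maxEntangled (a × b)) =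
      (Fintype.card (a × b) : ℂ)⁻¹ • (regroup M * (regroup M)ᴴ) := by
  ext ⟨p, s⟩ ⟨q, t⟩
  have h1 : (Matrix.of fun i j => maxEntangled (a × b) (i, s) (j, t)) =
      Matrix.single s t (Fintype.card (a × b) : ℂ)⁻¹ := by
    ext i j
    simp [maxEntangled, Matrix.single_apply, eq_comm]
  have h2 : ∀ x y, (M * Matrix.single s t (Fintype.card (a × b) : ℂ)⁻¹ * Mᴴ) x y =
      (Fintype.card (a × b) : ℂ)⁻¹ * (M x s * star (M y t)) := by
    intro x y
    rw [Matrix.mul_apply, Finset.sum_eq_single t]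
    · rw [Matrix.mul_single_apply_same, conjTranspose_apply]
      ring
    · intro t' _ ht
      rw [Matrix.mul_single_apply_of_ne _ _ _ _ _ ht, zero_mul]
    · simp
  change traceGeom (M * (Matrix.of fun i j => maxEntangled (a × b) (i, s) (j, t)) * Mᴴ) p q = _
  rw [h1]
  simp only [Matrix.of_apply, traceGeom, h2, Matrix.smul_apply, smul_eq_mul,
    Matrix.mul_apply, conjTranspose_apply, regroup_apply, Fintype.sum_prod_type, Finset.mul_sum]

theorem traceRight_attach {χ : a₂ × b₂ → ℂ} (hχ : star χ ⬝ᵥ χ = 1) :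
    traceRight (regroup (attach (a := a) (b := b) χ) *
      (regroup (attach (a := a) (b := b) χ))ᴴ) = 1 := by
  have h1 : ∀ p q, (regroup (attach (a := a) (b := b) χ) *
      (regroup (attach (a := a) (b := b) χ))ᴴ) p q = flatten 1 p * star (flatten 1 q) := by
    intro p q
    rw [regroup_attach, Matrix.mul_apply]
    simp only [vecMulVec_apply, conjTranspose_apply, star_mul']
    calc _ = ∑ e, flatten 1 p * star (flatten 1 q) * (star (χ e) * χ e) :=
          Finset.sum_congr rfl fun e _ => by ring
      _ = flatten 1 p * star (flatten 1 q) * (star χ ⬝ᵥ χ) := by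
          rw [← Finset.mul_sum]
          rfl
      _ = _ := by rw [hχ, mul_one]
  ext i j
  simp only [traceRight, Matrix.of_apply, h1, flatten, Matrix.one_apply]
  rw [Finset.sum_eq_single i]
  · by_cases h : i = j
    · simp [h]
    · simp [h, Ne.symm h]
  · intro k _ hk
    simp [hk.symm]
  · simp

theorem HasEntryDeriv.regroup {M : ℝ → Matrix ((a × a₂) × (b × b₂)) (a × b) ℂ}
    {H : Matrix ((a × a₂) × (b × b₂)) (a × b) ℂ} (h : HasEntryDeriv M H) :
    HasEntryDeriv (fun ε => regroup (M ε)) (_root_.regroup H) := fun _ _ => h _ _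

theorem sum_norm_sq_regroup {M : Matrix ((a × a₂) × (b × b₂)) (a × b) ℂ} (hM : Mᴴ * M = 1) :
    ∑ q, ∑ e, ‖regroup M q e‖ ^ 2 = Fintype.card (a × b) := by
  have h := trace_regroup M M
  rw [hM, trace_one, Matrix.trace_mul_comm] at h
  apply Complex.ofReal_injective
  push_cast
  rw [← h]
  simp only [Matrix.trace, Matrix.diag_apply, Matrix.mul_apply, conjTranspose_apply]
  exact Finset.sum_congr rfl fun q _ => Finset.sum_congr rfl fun e _ =>
    (Complex.mul_conj' _).symm

/-- Leading-order expansion of the coherent information of a channel with Stinespring isometry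
`M ε`, starting from the ideal isometry `attach χ`. -/
theorem tendsto_coherentInformation [Nonempty a] [Nonempty b] {χ : a₂ × b₂ → ℂ}
    (hχ : star χ ⬝ᵥ χ = 1) {M : ℝ → Matrix ((a × a₂) × (b × b₂)) (a × b) ℂ}
    {H : Matrix ((a × a₂) × (b × b₂)) (a × b) ℂ} (hM : ∀ ε, (M ε)ᴴ * M ε = 1)
    (h0 : M 0 = attach χ) (hd : HasEntryDeriv M H) :
    Tendsto (fun ε => (coherentInformation
      (fun σ : Matrix (a × b) (a × b) ℂ => traceGeom (M ε * σ * (M ε)ᴴ)) -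
      Real.log (Fintype.card (a × b))) / (ε ^ 2 * Real.log (1 / ε))) (𝓝[>] 0)
      (𝓝 (-(‖tangentMinors (regroup (attach (a := a) (b := b) χ)) (regroup H)‖ ^ 2 /
        (2 * (Fintype.card (a × b) : ℝ) ^ 2)))) := by
  have hN : (Fintype.card (a × b) : ℝ) ≠ 0 := by exact_mod_cast Fintype.card_ne_zero
  have hN' : (Fintype.card (a × b) : ℂ) ≠ 0 := by exact_mod_cast Fintype.card_ne_zero
  let ρ : ℝ → Matrix ((a × b) × (a × b)) ((a × b) × (a × b)) ℂ := fun ε =>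
    (Fintype.card (a × b) : ℂ)⁻¹ • (regroup (M ε) * (regroup (M ε))ᴴ)
  have hρ : ∀ ε, (ρ ε).PosSemidef := fun ε =>
    (posSemidef_self_mul_conjTranspose _).smul (by
      rw [← Complex.ofReal_natCast, ← Complex.ofReal_inv, Complex.zero_le_real]
      positivity)
  have ht : ∀ ε, (ρ ε).trace = 1 := fun ε => by
    rw [trace_smul, Matrix.trace_mul_comm, trace_regroup, hM, trace_one, smul_eq_mul,
      inv_mul_cancel₀ hN']
  have hpure : Tendsto (fun ε => (1 - ∑ i, ∑ j, ‖ρ ε i j‖ ^ 2) / ε ^ 2) (𝓝[>] 0)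
      (𝓝 (‖tangentMinors (regroup (attach (a := a) (b := b) χ)) (regroup H)‖ ^ 2 /
        (2 * (Fintype.card (a × b) : ℝ) ^ 2))) := by
    have h1 := tendsto_minors hd.regroup (by rw [h0, regroup_attach, minors_vecMulVec])
    rw [h0] at h1
    refine (h1.div_const (2 * (Fintype.card (a × b) : ℝ) ^ 2)).congr fun ε => ?_
    have h2 := sum_norm_sq_gram (regroup (M ε))
    rw [sum_norm_sq_regroup (hM ε)] at h2
    have h3 : ∑ i, ∑ j, ‖ρ ε i j‖ ^ 2 = ((Fintype.card (a × b) : ℝ)⁻¹) ^ 2 *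
        ∑ i, ∑ j, ‖(regroup (M ε) * (regroup (M ε))ᴴ) i j‖ ^ 2 := by
      simp only [Finset.mul_sum, ρ, Matrix.smul_apply, smul_eq_mul, norm_mul, mul_pow, norm_inv,
        Complex.norm_natCast]
    rw [h3, div_right_comm]
    congr 1
    rw [div_eq_iff (by positivity)]
    have h4 : (Fintype.card (a × b) : ℝ)⁻¹ * Fintype.card (a × b) = 1 := inv_mul_cancel₀ hN
    field_simp
    linarith
  have hS := tendsto_vonNeumannEntropy_near_pure hρ ht hpure
  have hunif : Tendsto (fun ε => (vonNeumannEntropy (traceRight (ρ ε)) -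
      Real.log (Fintype.card (a × b))) / (ε ^ 2 * Real.log (1 / ε))) (𝓝[>] 0) (𝓝 0) := by
    have ht' : ∀ ε, (traceRight (ρ ε)).trace = 1 := fun ε => by rw [trace_traceRight, ht]
    have hd2 := hd.regroup.mul hd.regroup.conjTranspose
    -- This `q` is the squared norm of the derivative of the output state, times the dimension; only
    -- its finiteness matters.
    refine tendsto_vonNeumannEntropy_near_uniform (q := Fintype.card (a × b) * ∑ i, ∑ j,
      ‖∑ k, (Fintype.card (a × b) : ℂ)⁻¹ • (regroup H * (regroup (M 0))ᴴ +
        regroup (M 0) * (regroup H)ᴴ) (i, k) (j, k)‖ ^ 2) (fun ε => (hρ ε).traceRight) ht' ?_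
    simp only [fun ε => sum_norm_sub_uniform (ht' ε), mul_div_assoc, Finset.sum_div]
    refine Tendsto.const_mul _ (tendsto_finsetSum _ fun i _ => tendsto_finsetSum _ fun j _ =>
      tendsto_norm_sq_div ?_ ?_)
    · refine HasDerivAt.sub_const _ (HasDerivAt.fun_sum fun k _ => ?_)
      exact (hd2 (i, k) (j, k)).const_mul _
    · have h1 : traceRight (ρ 0) = (Fintype.card (a × b) : ℂ)⁻¹ • 1 := by
        rw [← traceRight_attach (a := a) (b := b) hχ, ← h0]
        ext i j
        simp only [traceRight, ρ, Matrix.smul_apply, Matrix.of_apply, Finset.smul_sum]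
      rw [h1, sub_self]
  have := hunif.sub hS
  rw [zero_sub] at this
  refine this.congr fun ε => ?_
  rw [coherentInformation, applyLeft_maxEntangled, ← sub_div]
  congr 1
  ring

end Code

/-! ### Contributions of local operators to `D` and `J`. -/

section Code

set_option linter.unusedSectionVars false

variable {a b a₂ b₂ : Type*} [Fintype a] [DecidableEq a] [Fintype b] [DecidableEq b]
  [Fintype a₂] [DecidableEq a₂] [Fintype b₂] [DecidableEq b₂]

theorem Matrix.sub_kronecker {l m n p : Type*} (A B : Matrix l m ℂ) (D : Matrix n p ℂ) :
    (A - B) ⊗ₖ D = A ⊗ₖ D - B ⊗ₖ D := by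
  ext
  simp [sub_mul]

theorem Matrix.kronecker_sub {l m n p : Type*} (A : Matrix l m ℂ) (B D : Matrix n p ℂ) :
    A ⊗ₖ (B - D) = A ⊗ₖ B - A ⊗ₖ D := by
  ext
  simp [mul_sub]

theorem trace_prodOp_mul_chiOp (χ : a₂ × b₂ → ℂ) (F : Matrix a a ℂ) (G : Matrix a₂ a₂ ℂ)
    (E : Matrix b b ℂ) (G' : Matrix b₂ b₂ ℂ) :
    (prodOp F G E G' * chiOp χ).trace =
      F.trace * E.trace * (star χ ⬝ᵥ (G ⊗ₖ G') *ᵥ χ) := by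
  rw [chiOp_eq, ← Matrix.mul_assoc, Matrix.trace_mul_comm, ← trace_regroup, regroup_prodOp,
    regroup_attach, conjTranspose_vecMulVec,
    vecMulVec_mul_vecMulVec, dotProduct_flatten_one, trace_kronecker, trace_vecMulVec,
    dotProduct_smul, smul_eq_mul]

theorem trace_mul_commutator {n : Type*} [Fintype n] (Y O Z : Matrix n n ℂ) :
    (Y * (O * Z - Z * O)).trace = ((Y * O - O * Y) * Z).trace := by
  simp only [Matrix.mul_sub, Matrix.sub_mul, trace_sub]
  rw [← Matrix.mul_assoc, ← Matrix.mul_assoc, Matrix.trace_mul_comm (Y * Z), Matrix.mul_assoc O]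

theorem trace_mul_anticommutator {n : Type*} [Fintype n] (Y O Z : Matrix n n ℂ) :
    (Y * (O * Z + Z * O)).trace = ((Y * O + O * Y) * Z).trace := by
  simp only [Matrix.mul_add, Matrix.add_mul, trace_add]
  rw [← Matrix.mul_assoc, ← Matrix.mul_assoc, Matrix.trace_mul_comm (Y * Z), Matrix.mul_assoc O]

theorem opJ_add (χ : a₂ × b₂ → ℂ)
    (X Y : Matrix ((a × a₂) × (b × b₂)) ((a × a₂) × (b × b₂)) ℂ) :
    opJ χ (X + Y) = opJ χ X + opJ χ Y := by
  ext p q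
  simp only [opJ, traceB₂, Matrix.add_mul, Matrix.mul_add, Matrix.smul_apply, Matrix.add_apply,
    Matrix.of_apply, Finset.sum_add_distrib, smul_add]
  abel

theorem opD_add (χ : a₂ × b₂ → ℂ)
    (X Y : Matrix ((a × a₂) × (b × b₂)) ((a × a₂) × (b × b₂)) ℂ) :
    opD χ (X + Y) = opD χ X + opD χ Y := by
  ext p q
  simp only [opD, traceB₂, Matrix.add_mul, Matrix.mul_add, Matrix.smul_apply, Matrix.add_apply,
    Matrix.sub_apply, Matrix.of_apply, Finset.sum_add_distrib, Finset.sum_sub_distrib, smul_add,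
    smul_sub]
  abel

theorem trace_mul_opD (χ : a₂ × b₂ → ℂ) (F : Matrix a a ℂ) (E : Matrix b b ℂ)
    (G : Matrix a₂ a₂ ℂ) (X : Matrix ((a × a₂) × (b × b₂)) ((a × a₂) × (b × b₂)) ℂ) :
    ((F ⊗ₖ (E ⊗ₖ G)) * opD χ X).trace =
      (Complex.I * (Fintype.card a₂ : ℂ)) *
        (prodOp F G E 1 * (X * chiOp χ - chiOp χ * X)).trace := by
  rw [opD, Matrix.mul_smul, trace_smul, trace_mul_traceB₂, smul_eq_mul]

/-- Flatness reduces `chiOp` to a multiple of the identity on `A`, so only `M.trace` survives, and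
commutators drop out. -/
theorem trace_left_mul_chiOp (C : FlatExactCode a b a₂ b₂) (E : Matrix b b ℂ)
    (M : Matrix (a × a₂) (a × a₂) ℂ) :
    ((M ⊗ₖ (E ⊗ₖ (1 : Matrix b₂ b₂ ℂ))) * chiOp C.χ).trace =
      (Fintype.card a₂ : ℂ)⁻¹ * E.trace * M.trace := by
  let f : Matrix (a × a₂) (a × a₂) ℂ →ₗ[ℂ] ℂ :=
    { toFun := fun M => ((M ⊗ₖ (E ⊗ₖ (1 : Matrix b₂ b₂ ℂ))) * chiOp C.χ).trace -
        (Fintype.card a₂ : ℂ)⁻¹ * E.trace * M.trace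
      map_add' := fun M N => by
        rw [add_kronecker, Matrix.add_mul, trace_add, trace_add]
        ring
      map_smul' := fun c M => by
        rw [smul_kronecker, Matrix.smul_mul, trace_smul, trace_smul]
        simp only [smul_eq_mul, RingHom.id_apply]
        ring }
  have hf : f = 0 := linearMap_eq_zero_of_kronecker fun F G => by
    change (prodOp F G E 1 * chiOp C.χ).trace - _ = 0
    rw [trace_prodOp_mul_chiOp, C.dotProduct_kronecker_one, trace_kronecker]
    ring
  exact sub_eq_zero.1 (DFunLike.congr_fun hf M)

theorem trace_right_mul_chiOp (χ : a₂ × b₂ → ℂ) {F : Matrix a a ℂ} (hF : F.trace = 0)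
    (G : Matrix a₂ a₂ ℂ) (N : Matrix (b × b₂) (b × b₂) ℂ) :
    (((F ⊗ₖ G) ⊗ₖ N) * chiOp χ).trace = 0 := by
  let f : Matrix (b × b₂) (b × b₂) ℂ →ₗ[ℂ] ℂ :=
    { toFun := fun N => (((F ⊗ₖ G) ⊗ₖ N) * chiOp χ).trace
      map_add' := fun M N => by rw [kronecker_add, Matrix.add_mul, trace_add]
      map_smul' := fun c M => by
        rw [kronecker_smul, Matrix.smul_mul, trace_smul, RingHom.id_apply] }
  have hf : f = 0 := linearMap_eq_zero_of_kronecker fun E G' => by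
    change (prodOp F G E G' * chiOp χ).trace = 0
    rw [trace_prodOp_mul_chiOp, hF, zero_mul, zero_mul]
  exact DFunLike.congr_fun hf N

/-- `chiOp` is the identity on `Ā₁`, so `E` may be cycled there. -/
theorem trace_right_commutator_mul_chiOp (χ : a₂ × b₂ → ℂ) (F : Matrix a a ℂ)
    (G : Matrix a₂ a₂ ℂ) (E : Matrix b b ℂ) (N : Matrix (b × b₂) (b × b₂) ℂ) :
    (((F ⊗ₖ G) ⊗ₖ ((E ⊗ₖ (1 : Matrix b₂ b₂ ℂ)) * N - N * (E ⊗ₖ (1 : Matrix b₂ b₂ ℂ)))) *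
      chiOp χ).trace = 0 := by
  let f : Matrix (b × b₂) (b × b₂) ℂ →ₗ[ℂ] ℂ :=
    { toFun := fun N => (((F ⊗ₖ G) ⊗ₖ ((E ⊗ₖ (1 : Matrix b₂ b₂ ℂ)) * N -
        N * (E ⊗ₖ (1 : Matrix b₂ b₂ ℂ)))) * chiOp χ).trace
      map_add' := fun M N => by
        rw [← trace_add, ← Matrix.add_mul, ← kronecker_add, Matrix.mul_add, Matrix.add_mul,
          add_sub_add_comm]
      map_smul' := fun c M => by
        rw [Matrix.mul_smul, Matrix.smul_mul, ← smul_sub, kronecker_smul, Matrix.smul_mul,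
          trace_smul, RingHom.id_apply] }
  have hf : f = 0 := linearMap_eq_zero_of_kronecker fun K L => by
    change (((F ⊗ₖ G) ⊗ₖ ((E ⊗ₖ (1 : Matrix b₂ b₂ ℂ)) * (K ⊗ₖ L) -
        (K ⊗ₖ L) * (E ⊗ₖ (1 : Matrix b₂ b₂ ℂ)))) * chiOp χ).trace = 0
    rw [← mul_kronecker_mul, ← mul_kronecker_mul, Matrix.one_mul, Matrix.mul_one, kronecker_sub,
      Matrix.sub_mul, trace_sub]
    change (prodOp F G (E * K) L * chiOp χ).trace - (prodOp F G (K * E) L * chiOp χ).trace = 0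
    rw [trace_prodOp_mul_chiOp, trace_prodOp_mul_chiOp, Matrix.trace_mul_comm E K, sub_self]
  exact DFunLike.congr_fun hf N

/-- Cyclicity moves the commutator onto the test operator. On `A` it is traceless, which suffices by
flatness; on `Ā` it is a commutator with an operator on `Ā₁`. All coefficients of `D` are thus
invariant. -/
theorem trace_mul_opD_local (C : FlatExactCode a b a₂ b₂) (F : Matrix a a ℂ) (E : Matrix b b ℂ)
    (G : Matrix a₂ a₂ ℂ) (OA : Matrix (a × a₂) (a × a₂) ℂ) (OB : Matrix (b × b₂) (b × b₂) ℂ) :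
    ((F ⊗ₖ (E ⊗ₖ G)) * opD C.χ (OA ⊗ₖ 1 + 1 ⊗ₖ OB)).trace = 0 := by
  rw [opD_add, Matrix.mul_add, trace_add, trace_mul_opD, trace_mul_opD, trace_mul_commutator,
    trace_mul_commutator, prodOp, ← mul_kronecker_mul, ← mul_kronecker_mul, ← mul_kronecker_mul,
    ← mul_kronecker_mul, Matrix.mul_one, Matrix.one_mul, Matrix.mul_one, Matrix.one_mul,
    ← kronecker_sub, trace_right_commutator_mul_chiOp, ← sub_kronecker, trace_left_mul_chiOp,
    trace_sub, Matrix.trace_mul_comm OA, sub_self]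
  ring

/-- For anticommutators the `OA` term carries the factor `E.trace` and the `OB` term the factor
`F.trace`; hence the restriction to `l, m > 0`. -/
theorem trace_mul_opJ_local (C : FlatExactCode a b a₂ b₂) {F : Matrix a a ℂ} {E : Matrix b b ℂ}
    (hF : F.trace = 0) (hE : E.trace = 0)
    (G : Matrix a₂ a₂ ℂ) (OA : Matrix (a × a₂) (a × a₂) ℂ) (OB : Matrix (b × b₂) (b × b₂) ℂ) :
    ((F ⊗ₖ (E ⊗ₖ G)) * opJ C.χ (OA ⊗ₖ 1 + 1 ⊗ₖ OB)).trace = 0 := by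
  rw [opJ_add, Matrix.mul_add, trace_add, trace_mul_opJ, trace_mul_opJ, trace_mul_anticommutator,
    trace_mul_anticommutator, prodOp, ← mul_kronecker_mul, ← mul_kronecker_mul,
    ← mul_kronecker_mul, ← mul_kronecker_mul, Matrix.mul_one, Matrix.one_mul, Matrix.mul_one,
    Matrix.one_mul, ← kronecker_add, trace_right_mul_chiOp _ hF, ← add_kronecker,
    trace_left_mul_chiOp, hE]
  ring

namespace PauliBases

variable (P : PauliBases a b a₂) (C : FlatExactCode a b a₂ b₂)

theorem coeff_opD_add_local (X : Matrix ((a × a₂) × (b × b₂)) ((a × a₂) × (b × b₂)) ℂ)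
    (OA : Matrix (a × a₂) (a × a₂) ℂ) (OB : Matrix (b × b₂) (b × b₂) ℂ) :
    P.coeff (opD C.χ (X + (OA ⊗ₖ 1 + 1 ⊗ₖ OB))) = P.coeff (opD C.χ X) := by
  ext l m n
  rw [coeff, coeff, conjTranspose_kronecker, conjTranspose_kronecker, opD_add C.χ X,
    Matrix.mul_add, trace_add, trace_mul_opD_local, add_zero]

theorem coeff_opJ_add_local (X : Matrix ((a × a₂) × (b × b₂)) ((a × a₂) × (b × b₂)) ℂ)
    (OA : Matrix (a × a₂) (a × a₂) ℂ) (OB : Matrix (b × b₂) (b × b₂) ℂ)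
    {l : Fin (Fintype.card a ^ 2)} {m : Fin (Fintype.card b ^ 2)} (n : Fin (Fintype.card a₂ ^ 2))
    (hl : 0 < (l : ℕ)) (hm : 0 < (m : ℕ)) :
    P.coeff (opJ C.χ (X + (OA ⊗ₖ 1 + 1 ⊗ₖ OB))) l m n = P.coeff (opJ C.χ X) l m n := by
  rw [coeff, coeff, conjTranspose_kronecker, conjTranspose_kronecker, opJ_add C.χ X,
    Matrix.mul_add, trace_add, trace_mul_opJ_local C (P.A.trace_conjTranspose_eq_zero hl)
      (P.B.trace_conjTranspose_eq_zero hm), add_zero]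

theorem sectorE_congr {X Y : Matrix (a × b × a₂) (a × b × a₂) ℂ}
    (h : ∀ (l : Fin (Fintype.card a ^ 2)) (m : Fin (Fintype.card b ^ 2)) n,
      0 < (l : ℕ) → 0 < (m : ℕ) → P.coeff X l m n = P.coeff Y l m n) :
    P.sectorE X = P.sectorE Y := by
  refine Finset.sum_congr rfl fun l _ => Finset.sum_congr rfl fun m _ =>
    Finset.sum_congr rfl fun n _ => ?_
  split_ifs with h1
  · rw [h l m n h1.1 h1.2.1]
  · rfl

end PauliBases

/-! ### Least squares over a real affine space. -/

theorem re_inner_eq_zero_of_norm_le {E : Type*} [NormedAddCommGroup E] [InnerProductSpace ℂ E]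
    {u v : E} (h : ∀ t : ℝ, ‖u‖ ≤ ‖u + (t : ℂ) • v‖) : (inner ℂ u v).re = 0 := by
  have h1 : ∀ t : ℝ, 0 ≤ 2 * t * (inner ℂ u v).re + t ^ 2 * ‖v‖ ^ 2 := by
    intro t
    have h2 := pow_le_pow_left₀ (norm_nonneg u) (h t) 2
    rw [norm_add_sq (𝕜 := ℂ), inner_smul_right, norm_smul, Complex.norm_real, mul_pow,
      Real.norm_eq_abs, sq_abs] at h2
    simp only [RCLike.re_to_complex, Complex.re_ofReal_mul] at h2
    linarith
  set r := (inner ℂ u v).re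
  -- Almost the minimizer of the quadratic; the `+ 1` covers `v = 0`.
  have h3 := h1 (-r / (‖v‖ ^ 2 + 1))
  have hp : 0 < ‖v‖ ^ 2 + 1 := by positivity
  have h4 : 2 * (-r / (‖v‖ ^ 2 + 1)) * r + (-r / (‖v‖ ^ 2 + 1)) ^ 2 * ‖v‖ ^ 2 =
      -(r ^ 2 * (‖v‖ ^ 2 + 2)) / (‖v‖ ^ 2 + 1) ^ 2 := by
    field_simp
    ring
  rw [h4, le_div_iff₀ (by positivity), zero_mul] at h3
  have h5 : r ^ 2 ≤ 0 := by nlinarith [sq_nonneg r, mul_nonneg (sq_nonneg r) (sq_nonneg ‖v‖)]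
  exact pow_eq_zero_iff two_ne_zero |>.1 (le_antisymm h5 (sq_nonneg r))

theorem norm_le_norm_add_of_re_inner_eq_zero {E : Type*} [NormedAddCommGroup E]
    [InnerProductSpace ℂ E] {u v : E} (h : (inner ℂ u v).re = 0) : ‖u‖ ≤ ‖u + v‖ := by
  have h1 := norm_add_sq (𝕜 := ℂ) u v
  rw [RCLike.re_to_complex, h] at h1
  exact le_of_sq_le_sq (by nlinarith [sq_nonneg ‖v‖]) (norm_nonneg _)

theorem re_inner_euclideanSpace {ι : Type*} [Fintype ι] (u v : EuclideanSpace ℂ ι) :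
    (inner ℂ u v).re = inner ℝ u v := by
  simp [PiLp.inner_apply, Complex.inner]

/-- Every operator becomes stationary after a suitable local Hermitian change. -/
theorem exists_isLeakStationary (χ : a₂ × b₂ → ℂ)
    (X : Matrix ((a × a₂) × (b × b₂)) ((a × a₂) × (b × b₂)) ℂ) :
    ∃ (OA : Matrix (a × a₂) (a × a₂) ℂ) (OB : Matrix (b × b₂) (b × b₂) ℂ), OA.IsHermitian ∧
      OB.IsHermitian ∧ IsLeakStationary χ (X + (OA ⊗ₖ 1 + 1 ⊗ₖ OB)) := by
  -- The leaks of local Hermitian operators form only a real subspace; subtracting the projection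
  -- onto it leaves a stationary remainder.
  let K : Submodule ℝ (EuclideanSpace ℂ ((((a × b) × (a × b)) × ((a × b) × (a × b))) ×
      ((a₂ × b₂) × (a₂ × b₂)))) :=
    { carrier := {v | ∃ (OA : Matrix (a × a₂) (a × a₂) ℂ) (OB : Matrix (b × b₂) (b × b₂) ℂ),
        OA.IsHermitian ∧ OB.IsHermitian ∧ v = leak χ (OA ⊗ₖ 1 + 1 ⊗ₖ OB)}
      zero_mem' := ⟨0, 0, isHermitian_zero, isHermitian_zero, by simp⟩
      add_mem' := by
        rintro _ _ ⟨OA, OB, hA, hB, rfl⟩ ⟨OA', OB', hA', hB', rfl⟩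
        refine ⟨OA + OA', OB + OB', hA.add hA', hB.add hB', ?_⟩
        rw [← map_add, add_kronecker, kronecker_add, add_add_add_comm]
      smul_mem' := by
        rintro c _ ⟨OA, OB, hA, hB, rfl⟩
        refine ⟨(c : ℂ) • OA, (c : ℂ) • OB, ?_, ?_, ?_⟩
        · rw [Matrix.IsHermitian, conjTranspose_smul, hA.eq]
          simp
        · rw [Matrix.IsHermitian, conjTranspose_smul, hB.eq]
          simp
        · rw [smul_kronecker, kronecker_smul, ← smul_add, map_smul]
          rfl }
  have hmem : K.starProjection (leak χ X) ∈ K := Submodule.starProjection_apply_mem K _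
  obtain ⟨OA, OB, hA, hB, hv⟩ := hmem
  refine ⟨-OA, -OB, hA.neg, hB.neg, fun OA' OB' hA' hB' => ?_⟩
  have h1 := Submodule.starProjection_inner_eq_zero (K := K) (leak χ X)
    (leak χ (OA' ⊗ₖ 1 + 1 ⊗ₖ OB')) ⟨OA', OB', hA', hB', rfl⟩
  rw [hv, ← map_sub, ← re_inner_euclideanSpace] at h1
  have e : X + ((-OA) ⊗ₖ 1 + 1 ⊗ₖ (-OB)) = X - (OA ⊗ₖ 1 + 1 ⊗ₖ OB) := by
    rw [← zero_sub OA, ← zero_sub OB, sub_kronecker, kronecker_sub, zero_kronecker,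
      kronecker_zero]
    abel
  rw [e]
  exact h1

end Code

/-! ### Recoveries, their generators and optimality. -/

section Code

set_option linter.unusedSectionVars false

variable {a b a₂ b₂ : Type*} [Fintype a] [DecidableEq a] [Fintype b] [DecidableEq b]
  [Fintype a₂] [DecidableEq a₂] [Fintype b₂] [DecidableEq b₂]

namespace FlatExactCode

variable (C : FlatExactCode a b a₂ b₂) (W : Matrix ((a × a₂) × (b × b₂)) ((a × a₂) × (b × b₂)) ℂ)

theorem recovery_unitary :
    C.RA ⊗ₖ C.RB ∈ Matrix.unitaryGroup ((a × a₂) × (b × b₂)) ℂ :=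
  Matrix.kronecker_mem_unitary C.RA_unitary C.RB_unitary

theorem conjTranspose_mul_recovery : (C.RA ⊗ₖ C.RB)ᴴ * (C.RA ⊗ₖ C.RB) = 1 :=
  Matrix.mem_unitaryGroup_iff'.1 C.recovery_unitary

variable {C}

namespace RecoveryFamily

variable (R : C.RecoveryFamily)

theorem effective_zero : R.effective W 0 = 1 := by
  rw [effective, R.RA_zero, R.RB_zero, expI_zero, Matrix.mul_one]
  exact Matrix.mem_unitaryGroup_iff.1 C.recovery_unitary

theorem effective_mul_attach (ε : ℝ) :
    R.effective W ε * attach (a := a) (b := b) C.χ = (R.RA ε ⊗ₖ R.RB ε) * (expI ε W * C.V) := by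
  rw [effective, ← C.recovers]
  simp only [Matrix.mul_assoc]
  rw [← Matrix.mul_assoc (C.RA ⊗ₖ C.RB)ᴴ, C.conjTranspose_mul_recovery, Matrix.one_mul]

theorem skewedIc_eq (ε : ℝ) : C.skewedIc W ε (R.RA ε) (R.RB ε) =
    coherentInformation (fun σ : Matrix (a × b) (a × b) ℂ =>
      traceGeom ((R.effective W ε * attach (a := a) (b := b) C.χ) * σ *
        (R.effective W ε * attach (a := a) (b := b) C.χ)ᴴ)) := by
  simp only [effective_mul_attach]
  rfl

variable {W}

theorem effective_isometry [Nonempty a₂] (hW : W.IsHermitian) (ε : ℝ) :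
    (R.effective W ε * attach (a := a) (b := b) C.χ)ᴴ *
      (R.effective W ε * attach (a := a) (b := b) C.χ) = 1 := by
  have hu : R.effective W ε ∈ Matrix.unitaryGroup ((a × a₂) × (b × b₂)) ℂ :=
    mul_mem (mul_mem (Matrix.kronecker_mem_unitary (R.RA_unitary ε) (R.RB_unitary ε))
      (expI_mem_unitary hW ε)) (Unitary.star_mem C.recovery_unitary)
  have h1 : (R.effective W ε)ᴴ * R.effective W ε = 1 := Matrix.mem_unitaryGroup_iff'.1 hu
  rw [conjTranspose_mul, Matrix.mul_assoc, ← Matrix.mul_assoc _ (R.effective W ε), h1,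
    Matrix.one_mul, attach_isometry C.star_dotProduct_self]

variable (W)

/-- `OA` and `OB` are the Hermitian generators of the recovery at `ε = 0`. -/
structure HasGenerators (OA : Matrix (a × a₂) (a × a₂) ℂ) (OB : Matrix (b × b₂) (b × b₂) ℂ) :
    Prop where
  isHermitian_left : OA.IsHermitian
  isHermitian_right : OB.IsHermitian
  left : HasEntryDeriv R.RA (Complex.I • (OA * C.RA))
  right : HasEntryDeriv R.RB (Complex.I • (OB * C.RB))

theorem exists_hasGenerators : ∃ OA OB, R.HasGenerators OA OB := by
  obtain ⟨OA, hA, hA'⟩ := exists_generator R.RA_unitary R.RA_diff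
  obtain ⟨OB, hB, hB'⟩ := exists_generator R.RB_unitary R.RB_diff
  rw [R.RA_zero] at hA'
  rw [R.RB_zero] at hB'
  exact ⟨OA, OB, hA, hB, hA', hB'⟩

variable {R} {OA : Matrix (a × a₂) (a × a₂) ℂ} {OB : Matrix (b × b₂) (b × b₂) ℂ}

theorem HasGenerators.hasEntryDeriv_effective (h : R.HasGenerators OA OB) :
    HasEntryDeriv (R.effective W) (Complex.I •
      (OA ⊗ₖ 1 + 1 ⊗ₖ OB + (C.RA ⊗ₖ C.RB) * W * (C.RA ⊗ₖ C.RB)ᴴ)) := by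
  have h1 := ((h.left.kronecker h.right).mul (HasEntryDeriv.expI W)).mul
    (HasEntryDeriv.const (C.RA ⊗ₖ C.RB)ᴴ)
  have hU : (C.RA ⊗ₖ C.RB) * (C.RA ⊗ₖ C.RB)ᴴ = 1 :=
    Matrix.mem_unitaryGroup_iff.1 C.recovery_unitary
  have e1 : (OA * C.RA) ⊗ₖ C.RB = (OA ⊗ₖ 1) * (C.RA ⊗ₖ C.RB) := by
    rw [← mul_kronecker_mul, Matrix.one_mul]
  have e2 : C.RA ⊗ₖ (OB * C.RB) = (1 ⊗ₖ OB) * (C.RA ⊗ₖ C.RB) := by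
    rw [← mul_kronecker_mul, Matrix.one_mul]
  convert h1 using 1
  · rfl
  rw [R.RA_zero, R.RB_zero, expI_zero, smul_kronecker, kronecker_smul, e1, e2, ← smul_add,
    Matrix.mul_zero, add_zero, Matrix.mul_one, Matrix.mul_smul, ← smul_add, Matrix.smul_mul,
    Matrix.add_mul, Matrix.add_mul, Matrix.mul_assoc _ (C.RA ⊗ₖ C.RB), hU, Matrix.mul_one,
    Matrix.mul_assoc _ (C.RA ⊗ₖ C.RB), hU, Matrix.mul_one]

theorem WR_eq_of_hasEntryDeriv {X : Matrix ((a × a₂) × (b × b₂)) ((a × a₂) × (b × b₂)) ℂ}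
    (h : HasEntryDeriv (R.effective W) (Complex.I • X)) : R.WR W = X := by
  ext p q
  rw [WR, Matrix.of_apply, (h p q).deriv, Matrix.smul_apply, smul_eq_mul, ← mul_assoc]
  simp

theorem HasGenerators.WR_eq (h : R.HasGenerators OA OB) :
    R.WR W = OA ⊗ₖ 1 + 1 ⊗ₖ OB + (C.RA ⊗ₖ C.RB) * W * (C.RA ⊗ₖ C.RB)ᴴ :=
  WR_eq_of_hasEntryDeriv W (h.hasEntryDeriv_effective W)

theorem HasGenerators.of_expI_mul (h : R.HasGenerators OA OB) {S : C.RecoveryFamily}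
    {OA' : Matrix (a × a₂) (a × a₂) ℂ} {OB' : Matrix (b × b₂) (b × b₂) ℂ} (hA : OA'.IsHermitian)
    (hB : OB'.IsHermitian) (hSA : ∀ ε, S.RA ε = expI ε OA' * R.RA ε)
    (hSB : ∀ ε, S.RB ε = expI ε OB' * R.RB ε) : S.HasGenerators (OA' + OA) (OB' + OB) where
  isHermitian_left := hA.add h.isHermitian_left
  isHermitian_right := hB.add h.isHermitian_right
  left := by
    have h1 := (HasEntryDeriv.expI OA').mul h.left
    rw [expI_zero, Matrix.one_mul, R.RA_zero, Matrix.smul_mul, ← smul_add, ← Matrix.add_mul] at h1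
    rwa [funext hSA]
  right := by
    have h1 := (HasEntryDeriv.expI OB').mul h.right
    rw [expI_zero, Matrix.one_mul, R.RB_zero, Matrix.smul_mul, ← smul_add, ← Matrix.add_mul] at h1
    rwa [funext hSB]

/-- A local change of the recovery shifts `W_R` by local terms. -/
theorem WR_of_expI_mul (R S : C.RecoveryFamily) (hA : OA.IsHermitian) (hB : OB.IsHermitian)
    (hSA : ∀ ε, S.RA ε = expI ε OA * R.RA ε) (hSB : ∀ ε, S.RB ε = expI ε OB * R.RB ε) :
    S.WR W = R.WR W + (OA ⊗ₖ 1 + 1 ⊗ₖ OB) := by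
  obtain ⟨OA', OB', h⟩ := R.exists_hasGenerators
  rw [h.WR_eq, (h.of_expI_mul hA hB hSA hSB).WR_eq, add_kronecker, kronecker_add]
  abel

/-- All recoveries agree at `ε = 0`, so their `W_R` differ only by the generators. With `shift`, the
possible `W_R` fill a real affine space. -/
theorem exists_WR_eq_add (R S : C.RecoveryFamily) :
    ∃ (OA : Matrix (a × a₂) (a × a₂) ℂ) (OB : Matrix (b × b₂) (b × b₂) ℂ), OA.IsHermitian ∧
      OB.IsHermitian ∧ S.WR W = R.WR W + (OA ⊗ₖ 1 + 1 ⊗ₖ OB) := by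
  obtain ⟨OA, OB, h⟩ := R.exists_hasGenerators
  obtain ⟨OA', OB', h'⟩ := S.exists_hasGenerators
  refine ⟨OA' - OA, OB' - OB, h'.isHermitian_left.sub h.isHermitian_left,
    h'.isHermitian_right.sub h.isHermitian_right, ?_⟩
  rw [h.WR_eq, h'.WR_eq, sub_kronecker, kronecker_sub]
  abel

variable (R) in
theorem hasEntryDeriv_effective : HasEntryDeriv (R.effective W) (Complex.I • R.WR W) := by
  obtain ⟨OA, OB, h⟩ := R.exists_hasGenerators
  rw [h.WR_eq]
  exact h.hasEntryDeriv_effective W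

variable (R) in
theorem WR_isHermitian {W : Matrix ((a × a₂) × (b × b₂)) ((a × a₂) × (b × b₂)) ℂ}
    (hW : W.IsHermitian) : (R.WR W).IsHermitian := by
  obtain ⟨OA, OB, h⟩ := R.exists_hasGenerators
  rw [h.WR_eq]
  exact ((h.isHermitian_left.kronecker_one _).add (h.isHermitian_right.one_kronecker _)).add
    (isHermitian_mul_mul_conjTranspose _ hW)

/-- The recovery `e^{iεO_A} R_A`, `e^{iεO_B} R_Ā`. -/
noncomputable def shift (R : C.RecoveryFamily) (hA : OA.IsHermitian) (hB : OB.IsHermitian) :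
    C.RecoveryFamily where
  RA ε := expI ε OA * R.RA ε
  RB ε := expI ε OB * R.RB ε
  RA_unitary ε := mul_mem (expI_mem_unitary hA ε) (R.RA_unitary ε)
  RB_unitary ε := mul_mem (expI_mem_unitary hB ε) (R.RB_unitary ε)
  RA_zero := by rw [expI_zero, Matrix.one_mul, R.RA_zero]
  RB_zero := by rw [expI_zero, Matrix.one_mul, R.RB_zero]
  RA_diff i j := by
    obtain ⟨_, _, h⟩ := R.exists_hasGenerators
    exact ((HasEntryDeriv.expI OA).mul h.left i j).differentiableAt
  RB_diff i j := by
    obtain ⟨_, _, h⟩ := R.exists_hasGenerators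
    exact ((HasEntryDeriv.expI OB).mul h.right i j).differentiableAt

theorem WR_shift (R : C.RecoveryFamily) (hA : OA.IsHermitian) (hB : OB.IsHermitian) :
    (R.shift hA hB).WR W = R.WR W + (OA ⊗ₖ 1 + 1 ⊗ₖ OB) :=
  WR_of_expI_mul W R _ hA hB (fun _ => rfl) fun _ => rfl

variable {W} [Nonempty a] [Nonempty b] [Nonempty a₂]

/-- `I_c = log (d d̄) - ‖leak W_R‖² / (2 d² d̄²) ε² log (1/ε) + o(ε² log (1/ε))`. -/
theorem tendsto_skewedIc (R : C.RecoveryFamily) (hW : W.IsHermitian) :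
    Tendsto (fun ε => (C.skewedIc W ε (R.RA ε) (R.RB ε) - Real.log (Fintype.card (a × b))) /
      (ε ^ 2 * Real.log (1 / ε))) (𝓝[>] 0)
      (𝓝 (-(‖leak C.χ (R.WR W)‖ ^ 2 / (2 * (Fintype.card (a × b) : ℝ) ^ 2)))) := by
  have hd : HasEntryDeriv (fun ε => R.effective W ε * attach (a := a) (b := b) C.χ)
      ((Complex.I • R.WR W) * attach (a := a) (b := b) C.χ) := by
    simpa using (R.hasEntryDeriv_effective W).mul
      (HasEntryDeriv.const (attach (a := a) (b := b) C.χ))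
  have h := tendsto_coherentInformation C.star_dotProduct_self (R.effective_isometry hW)
    (by rw [effective_zero, Matrix.one_mul]) hd
  rw [← leak_apply, map_smul, norm_smul, Complex.norm_I, one_mul] at h
  simpa only [skewedIc_eq] using h

/-- The tolerance `c ε² log (1/ε)`, with `c > 0` arbitrary, absorbs exactly the error of
`tendsto_skewedIc`, so only the limits are compared. -/
theorem isOptimal_iff_norm_le (R : C.RecoveryFamily) (hW : W.IsHermitian) :
    R.IsOptimal W ↔
      ∀ S : C.RecoveryFamily, ‖leak C.χ (R.WR W)‖ ≤ ‖leak C.χ (S.WR W)‖ := by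
  have hD : (0 : ℝ) < 2 * (Fintype.card (a × b) : ℝ) ^ 2 := by positivity
  refine forall_congr' fun S => ?_
  have hlim := (S.tendsto_skewedIc hW).sub (R.tendsto_skewedIc hW)
  set u := ‖leak C.χ (R.WR W)‖
  set v := ‖leak C.χ (S.WR W)‖
  have hlim' : Tendsto (fun ε => (C.skewedIc W ε (S.RA ε) (S.RB ε) -
      C.skewedIc W ε (R.RA ε) (R.RB ε)) / (ε ^ 2 * Real.log (1 / ε))) (𝓝[>] 0)
      (𝓝 ((u ^ 2 - v ^ 2) / (2 * (Fintype.card (a × b) : ℝ) ^ 2))) := by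
    convert hlim using 2
    · rw [← sub_div]
      congr 1
      ring
    · ring
  have hiff : u ≤ v ↔ (u ^ 2 - v ^ 2) / (2 * (Fintype.card (a × b) : ℝ) ^ 2) ≤ 0 := by
    rw [div_le_iff₀ hD, zero_mul, sub_nonpos,
      pow_le_pow_iff_left₀ (norm_nonneg _) (norm_nonneg _) two_ne_zero]
  rw [hiff]
  constructor
  · intro h
    refine le_of_forall_pos_le_add fun c hc => ?_
    rw [zero_add]
    refine le_of_tendsto hlim' ?_
    filter_upwards [h c hc, eventually_log_one_div_pos] with ε h1 ⟨hε, hl⟩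
    rw [div_le_iff₀ (by positivity)]
    linarith
  · intro h c hc
    filter_upwards [hlim'.eventually_lt_const (h.trans_lt hc), eventually_log_one_div_pos] with
      ε h1 ⟨hε, hl⟩
    rw [div_lt_iff₀ (by positivity)] at h1
    linarith

/-- Minimality along each real line of shifts forces orthogonality; conversely, Pythagoras gives the
global minimum. -/
theorem isOptimal_iff_isLeakStationary (R : C.RecoveryFamily) (hW : W.IsHermitian) :
    R.IsOptimal W ↔ IsLeakStationary C.χ (R.WR W) := by
  rw [R.isOptimal_iff_norm_le hW]
  constructor
  · intro h OA OB hA hB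
    refine re_inner_eq_zero_of_norm_le fun t => ?_
    have h1 := h (R.shift (OA := (t : ℂ) • OA) (OB := (t : ℂ) • OB)
      (by rw [Matrix.IsHermitian, conjTranspose_smul, hA.eq]; simp)
      (by rw [Matrix.IsHermitian, conjTranspose_smul, hB.eq]; simp))
    rwa [WR_shift, smul_kronecker, kronecker_smul, ← smul_add, map_add, map_smul] at h1
  · intro h S
    obtain ⟨OA, OB, hA, hB, hS⟩ := exists_WR_eq_add W R S
    rw [hS, map_add]
    exact norm_le_norm_add_of_re_inner_eq_zero (h OA OB hA hB)

/-- A recovery that maximizes the coherent information for all small `ε` is optimal. -/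
theorem isOptimal_of_isMaximizer (R : C.RecoveryFamily)
    (h : ∀ᶠ ε in 𝓝[>] (0 : ℝ), C.IsMaximizer W ε (R.RA ε) (R.RB ε)) : R.IsOptimal W := by
  intro S c hc
  filter_upwards [h, eventually_log_one_div_pos] with ε h1 ⟨hε, hl⟩
  have h2 := h1 _ (S.RA_unitary ε) _ (S.RB_unitary ε)
  have h3 : 0 ≤ c * (ε ^ 2 * Real.log (1 / ε)) := by positivity
  linarith

end RecoveryFamily

end FlatExactCode

end Code

end LeadingOrder

theorem mainTheorem12 {a b a₂ b₂ : Type*} [Fintype a] [DecidableEq a] [Fintype b] [DecidableEq b]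
    [Fintype a₂] [DecidableEq a₂] [Nonempty a₂] [Fintype b₂] [DecidableEq b₂]
    (ha : 2 ≤ Fintype.card a) (hb : 2 ≤ Fintype.card b)
    (C : FlatExactCode a b a₂ b₂)
    (W : Matrix ((a × a₂) × (b × b₂)) ((a × a₂) × (b × b₂)) ℂ) (hW : W.IsHermitian)
    (P : PauliBases a b a₂) :
    -- a recovery that maximizes the coherent information has `k₁(W_R) = 0`
    (∀ R : C.RecoveryFamily,
      (∀ᶠ ε in 𝓝[>] (0 : ℝ), C.IsMaximizer W ε (R.RA ε) (R.RB ε)) →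
        P.k₁ C.χ (R.WR W) = 0) ∧
    -- so has a recovery that maximizes it to leading order; moreover `B_J = 0`
    (∀ R : C.RecoveryFamily, R.IsOptimal W →
      P.k₁ C.χ (R.WR W) = 0 ∧ P.sectorB (opJ C.χ (R.WR W)) = 0) ∧
    -- the optimum is reached from every recovery by a local change of the recovery
    (∀ R : C.RecoveryFamily, ∃ (OA : Matrix (a × a₂) (a × a₂) ℂ) (OB : Matrix (b × b₂) (b × b₂) ℂ)
      (S : C.RecoveryFamily), OA.IsHermitian ∧ OB.IsHermitian ∧
        (∀ ε, S.RA ε = expI ε OA * R.RA ε) ∧ (∀ ε, S.RB ε = expI ε OB * R.RB ε) ∧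
        S.IsOptimal W) ∧
    -- conversely, for `dim Ā₂ = d_χ`, the optimum is reached when `k₁ = 0` and `B_J = 0`
    (Fintype.card b₂ = Fintype.card a₂ → ∀ R : C.RecoveryFamily,
      P.k₁ C.χ (R.WR W) = 0 → P.sectorB (opJ C.χ (R.WR W)) = 0 → R.IsOptimal W) ∧
    -- a local change of the recovery shifts `W_R` by local terms
    (∀ (R S : C.RecoveryFamily) (OA : Matrix (a × a₂) (a × a₂) ℂ)
      (OB : Matrix (b × b₂) (b × b₂) ℂ), OA.IsHermitian → OB.IsHermitian →
        (∀ ε, S.RA ε = expI ε OA * R.RA ε) → (∀ ε, S.RB ε = expI ε OB * R.RB ε) →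
        S.WR W = R.WR W + OA ⊗ₖ 1 + 1 ⊗ₖ OB) ∧
    -- the remaining coefficients do not depend on the recovery
    (∀ R S : C.RecoveryFamily,
      (∀ (l : Fin (Fintype.card a ^ 2)) (m : Fin (Fintype.card b ^ 2))
        (n : Fin (Fintype.card a₂ ^ 2)), 0 < (l : ℕ) → 0 < (m : ℕ) →
        P.coeff (opJ C.χ (S.WR W)) l m n = P.coeff (opJ C.χ (R.WR W)) l m n ∧
        P.coeff (opD C.χ (S.WR W)) l m n = P.coeff (opD C.χ (R.WR W)) l m n) ∧
      P.k₂ C.χ (S.WR W) = P.k₂ C.χ (R.WR W) ∧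
      P.k₃ C.χ (S.WR W) = P.k₃ C.χ (R.WR W) ∧
      P.k₄ C.χ (S.WR W) = P.k₄ C.χ (R.WR W) ∧
      P.k₅ C.χ (S.WR W) = P.k₅ C.χ (R.WR W)) := by
  have : Nonempty a := Fintype.card_pos_iff.1 (by omega)
  have : Nonempty b := Fintype.card_pos_iff.1 (by omega)
  have hopt : ∀ R : C.RecoveryFamily, R.IsOptimal W →
      P.k₁ C.χ (R.WR W) = 0 ∧ P.sectorB (opJ C.χ (R.WR W)) = 0 := fun R hR => by
    rw [P.k₁_eq_zero_iff ha]
    exact P.sectors_eq_zero_of_isLeakStationary C (R.WR_isHermitian hW)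
      ((R.isOptimal_iff_isLeakStationary hW).1 hR)
  refine ⟨fun R hR => (hopt R (R.isOptimal_of_isMaximizer hR)).1, hopt, ?_, ?_, ?_, ?_⟩
  · intro R
    obtain ⟨OA, OB, hA, hB, h⟩ := exists_isLeakStationary C.χ (R.WR W)
    refine ⟨OA, OB, R.shift hA hB, hA, hB, fun _ => rfl, fun _ => rfl, ?_⟩
    rwa [FlatExactCode.RecoveryFamily.isOptimal_iff_isLeakStationary _ hW,
      FlatExactCode.RecoveryFamily.WR_shift]
  · intro hcard R h1 h2
    exact (R.isOptimal_iff_isLeakStationary hW).2 (P.isLeakStationary_of_sectors_eq_zero C hcard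
      (R.WR_isHermitian hW) ((P.k₁_eq_zero_iff ha _ _).1 h1) h2)
  · intro R S OA OB hA hB hSA hSB
    rw [FlatExactCode.RecoveryFamily.WR_of_expI_mul W R S hA hB hSA hSB, add_assoc]
  · intro R S
    obtain ⟨OA, OB, -, -, hS⟩ := FlatExactCode.RecoveryFamily.exists_WR_eq_add W R S
    -- All coefficients of `D` are invariant, which settles `k₂`, `k₃` and `k₅`; for `k₄` the
    -- coefficients of `J` with `l, m > 0` suffice.
    have hD := P.coeff_opD_add_local C (R.WR W) OA OB
    have hJ := fun l m n hl hm => P.coeff_opJ_add_local C (R.WR W) OA OB (l := l) (m := m) n hl hm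
    rw [← hS] at hD
    simp only [← hS] at hJ
    refine ⟨fun l m n hl hm => ⟨hJ l m n hl hm, by rw [hD]⟩, ?_, ?_, ?_, ?_⟩
    · simp only [PauliBases.k₂, PauliBases.sectorC, hD]
    · simp only [PauliBases.k₃, PauliBases.sectorE, hD]
    · rw [PauliBases.k₄, PauliBases.k₄, P.sectorE_congr hJ]
    · simp only [PauliBases.k₅, PauliBases.sectorB, hD]
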